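/- Let $Sym=\mathbb{Q}[p_1,p_2,\dots]$ be the ring of symmetric functions, with power sums $p_k$, complete functions $h_n$ (so $h_0=1$ and $n h_n=\sum_{i=1}^n p_i h_{n-i}$), $h_\mu=h_{\mu_1}h_{\mu_2}\cdots$, and Schur functions $s_\lambda=\det[h_{\lambda_i+j-i}]$. The induced trivial character basis $\{\tilde h_\mu\}$ is defined recursively by $$h_\mu=\sum_{\pi}\tilde h_{\tilde m(\pi)},$$ where $\pi$ runs over the multiset partitions (into nonempty multisets) of the multiset $\{1^{\mu_1},2^{\mu_2},\dots\}$ and $\tilde m(\pi)$ is the partition formed by the multiplicities of the distinct multisets in $\pi$. The irreducible character basis $\{\tilde s_\lambda\}$ is defined by $$\tilde s_\lambda=\sum_{|\mu|\le|\lambda|}K^{-1}_{(n-|\lambda|,\lambda),(n-|\mu|,\mu)}\,\tilde h_\mu,\qquad n=2|\lambda|,$$ where $K^{-1}_{\alpha\beta}$ is the coefficient of $h_\beta$ in $s_\alpha$ (inverse Kostka coefficient). For partitions $\lambda,\alpha$, an integer $d\ge1$ and $r$ sufficiently large, let $\lambda/\!\!/\alpha$ (in size $d$) denote the skew diagram $(r-|\lambda|,\lambda)/(r-d-|\alpha|,\alpha)$.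 It is called a border strip of size $d$ if the diagram of $(r-d-|\alpha|,\alpha)$ is contained in that of $(r-|\lambda|,\lambda)$ and the $d$ cells of the difference are connected (through common edges) and contain no $2\times2$ square; $ht(\lambda/\!\!/\alpha)$ is the number of rows it occupies minus $1$. **Theorem.** For every integer $k>0$ and every partition $\lambda$, $$p_k\,\tilde s_\lambda=\sum_{\nu}\Bigl(\sum_{d\mid k}\sum_{\alpha}(-1)^{ht(\lambda/\!\!/\alpha)+ht(\nu/\!\!/\alpha)}\Bigr)\tilde s_\nu,$$ where $\nu$ runs over all partitions, only finitely many of which have a nonzero coefficient, and the inner sum is over all partitions $\alpha$ such that both $\lambda/\!\!/\alpha$ and $\nu/\!\!/\alpha$ are border strips of size $d$. In the coefficient of $\tilde s_\nu$ one may use any $r=r_\nu\ge k+2|\lambda|+2|\nu|$. -/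

import Mathlib

namespace IrrChar

open MvPolynomial

/-! ### The ring of symmetric functions -/

/-- The ring of symmetric functions `ℚ[p₁, p₂, …]`; the variable `X k` is the power sum `p_k`. -/
abbrev SymF : Type := MvPolynomial ℕ+ ℚ

/-- The power sum `p_k`. -/
noncomputable def powerSum (k : ℕ+) : SymF := X k

/-- The complete homogeneous symmetric function `h_n`, by Newton's identities
`h_0 = 1` and `n h_n = p_1 h_{n-1} + p_2 h_{n-2} + ⋯ + p_n h_0`. -/
noncomputable def completeH : ℕ → SymF
  | 0 => 1
  | n + 1 => C ((n + 1 : ℚ)⁻¹) * ∑ i : Fin (n + 1), powerSum (Nat.succPNat i) * completeH (n - i)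

/-- `h_n` for an integer index, with `h_n = 0` for `n < 0`. -/
noncomputable def completeHInt (n : ℤ) : SymF := if n < 0 then 0 else completeH n.toNat

/-- `h_μ = h_{μ_1} h_{μ_2} ⋯`. -/
noncomputable def completeHProd (μ : YoungDiagram) : SymF := (μ.rowLens.map completeH).prod

/-- The Schur function `s_α = det [h_{α_i + j - i}]` of a sequence `α` (Jacobi-Trudi). -/
noncomputable def schur (α : List ℕ) : SymF :=
  (Matrix.of fun i j : Fin α.length => completeHInt ((α.get i : ℤ) + (j : ℤ) - (i : ℤ))).det

/-! ### The complete basis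

Symmetric functions are polynomials in `h_1, h_2, …`, hence have well-defined coefficients with
respect to the products `h_β`. -/

/-- The polynomial in `h_1, h_2, …` (here the variables) that expresses `p_{n+1}`. -/
noncomputable def powerSumInH : ℕ → MvPolynomial ℕ+ ℚ
  | n => C (n + 1 : ℚ) * X (Nat.succPNat n) -
      ∑ i : Fin n, powerSumInH i * X (Nat.toPNat' (n - i))

lemma powerSumInH_eq (n : ℕ) : powerSumInH n = C (n + 1 : ℚ) * X (Nat.succPNat n) -
      ∑ i : Fin n, powerSumInH i * X (Nat.toPNat' (n - i)) := by
  rw [powerSumInH]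

lemma completeH_succ (n : ℕ) : C (n + 1 : ℚ) * completeH (n + 1) =
    ∑ i : Fin (n + 1), powerSum (Nat.succPNat i) * completeH (n - i) := by
  rw [completeH, ← mul_assoc, ← C_mul, mul_inv_cancel₀ (by positivity), C_1, one_mul]

/-- Substitute the complete symmetric functions for the variables. -/
noncomputable def fromH : MvPolynomial ℕ+ ℚ →ₐ[ℚ] SymF := aeval fun k : ℕ+ => completeH k

/-- Rewrite a symmetric function as a polynomial in `h_1, h_2, …`. -/
noncomputable def toH : SymF →ₐ[ℚ] MvPolynomial ℕ+ ℚ := aeval fun k : ℕ+ => powerSumInH k.natPred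

lemma fromH_powerSumInH (n : ℕ) : fromH (powerSumInH n) = X (Nat.succPNat n) := by
  induction n using Nat.strong_induction_on with
  | _ n ih =>
    have hC : fromH (C (n + 1 : ℚ)) = C (n + 1 : ℚ) := by
      rw [← algebraMap_eq, AlgHom.commutes]
    have hX : ∀ k : ℕ+, fromH (X k) = completeH k := fun k => by simp [fromH]
    rw [powerSumInH_eq, map_sub, map_mul, map_sum, hC, hX, Nat.succPNat_coe, Nat.succ_eq_add_one,
      completeH_succ, Fin.sum_univ_castSucc]
    have : ∀ i : Fin n, fromH (powerSumInH i * X (Nat.toPNat' (n - i))) =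
        powerSum (Nat.succPNat i) * completeH (n - i) := fun i => by
      have hi := i.2
      rw [map_mul, ih i i.2, hX, Nat.toPNat'_coe, if_pos (by omega), powerSum]
    simp [this, completeH, powerSum]

lemma toH_completeH (n : ℕ) : toH (completeH n) = if n = 0 then 1 else X (Nat.toPNat' n) := by
  induction n using Nat.strong_induction_on with
  | _ n ih =>
    rcases n with _ | n
    · simp [completeH]
    · have hC : ∀ a : ℚ, toH (C a) = C a := fun a => by
        rw [← algebraMap_eq, AlgHom.commutes]
      have hX : ∀ i : ℕ, toH (powerSum (Nat.succPNat i)) = powerSumInH i := fun i => by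
        simp [toH, powerSum]
      rw [completeH, map_mul, hC, map_sum, Fin.sum_univ_castSucc]
      have : ∀ i : Fin n, toH (powerSum (Nat.succPNat (i.castSucc : ℕ)) *
          completeH (n - (i.castSucc : ℕ))) = powerSumInH i * X (Nat.toPNat' (n - i)) := fun i => by
        have hi := i.2
        rw [map_mul, hX, ih _ (by simp), if_neg (by simp; omega)]
        simp
      rw [Finset.sum_congr rfl fun i _ => this i, map_mul, hX]
      simp only [Fin.val_last, Nat.sub_self, completeH, map_one, mul_one]
      rw [powerSumInH_eq n, add_sub_cancel, ← mul_assoc, ← C_mul,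
        inv_mul_cancel₀ (by positivity), C_1, one_mul]
      rfl

/-- The ring of symmetric functions is the polynomial ring in `h_1, h_2, …`. -/
noncomputable def equivH : MvPolynomial ℕ+ ℚ ≃ₐ[ℚ] SymF :=
  AlgEquiv.ofAlgHom fromH toH
    (by
      ext k : 1
      simp only [toH, AlgHom.comp_apply, aeval_X, fromH_powerSumInH, PNat.succPNat_natPred,
        AlgHom.id_apply])
    (by
      ext k : 1
      simp only [fromH, AlgHom.comp_apply, aeval_X, toH_completeH, PNat.ne_zero, if_false,
        PNat.coe_toPNat', AlgHom.id_apply])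

lemma equivH_X (k : ℕ+) : equivH (X k) = completeH k := by
  simp [equivH, fromH]

/-- The exponent vector of the monomial `h_β = h_{β_1} h_{β_2} ⋯` (with `h_0 = 1`). -/
noncomputable def hExponent (β : Multiset ℕ) : ℕ+ →₀ ℕ :=
  ((β.filter (0 < ·)).map fun a => Finsupp.single (Nat.toPNat' a) 1).sum

/-- The coefficient of `h_β` in the expansion of `f` in the complete basis. -/
noncomputable def hCoeff (β : Multiset ℕ) (f : SymF) : ℚ :=
  (equivH.symm f).coeff (hExponent β)

/-- The inverse Kostka coefficient `K⁻¹_{α β}`: the coefficient of `h_β` in `s_α`. -/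
noncomputable def inverseKostka (α : List ℕ) (β : Multiset ℕ) : ℚ := hCoeff β (schur α)

/-! ### Multiset partitions -/

/-- The partition with the given parts (in any order; zeros are irrelevant). -/
def ofParts (m : Multiset ℕ) : YoungDiagram :=
  YoungDiagram.ofRowLens (m.sort (· ≥ ·)) (m.pairwise_sort (· ≥ ·)).sortedGE

lemma card_cellsOfRowLens (w : List ℕ) : (YoungDiagram.cellsOfRowLens w).card = w.sum := by
  induction w with
  | nil => rfl
  | cons a w ih =>
    rw [YoungDiagram.cellsOfRowLens, Finset.card_union_of_disjoint, Finset.card_map, ih]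
    · simp
    · rw [Finset.disjoint_left]
      rintro ⟨i, j⟩ h1 h2
      simp at h1 h2
      omega

lemma card_ofParts (m : Multiset ℕ) : (ofParts m).card = m.sum := by
  have h : (ofParts m).card = (m.sort (· ≥ ·)).sum := card_cellsOfRowLens _
  rw [h, ← Multiset.sum_coe, Multiset.sort_eq]

/-- The multiset partitions `π` of the multiset `S`: multisets of nonempty multisets whose
union (with multiplicities) is `S`. -/
def multisetPartitions (S : Multiset ℕ) : Finset (Multiset (Multiset ℕ)) :=
  ((S.card • S.powerset).powerset.toFinset).filter fun π => 0 ∉ π ∧ π.sum = S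

lemma mem_multisetPartitions {S : Multiset ℕ} {π : Multiset (Multiset ℕ)} :
    π ∈ multisetPartitions S ↔ 0 ∉ π ∧ π.sum = S := by
  rw [multisetPartitions, Finset.mem_filter, and_iff_right_iff_imp]
  rintro ⟨h0, rfl⟩
  rw [Multiset.mem_toFinset, Multiset.mem_powerset, Multiset.le_iff_count]
  intro a
  by_cases ha : a ∈ π
  · have h1 : π.card ≤ π.sum.card := by
      have : ∀ π : Multiset (Multiset ℕ), 0 ∉ π → π.card ≤ π.sum.card := by
        intro π
        induction π using Multiset.induction_on with
        | empty => simp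
        | cons b π ih =>
          intro h
          rw [Multiset.mem_cons, not_or] at h
          have hb := Multiset.card_pos.2 (Ne.symm h.1)
          have := ih h.2
          rw [Multiset.sum_cons, Multiset.card_add, Multiset.card_cons]
          omega
      exact this π h0
    have h2 : 1 ≤ Multiset.count a π.sum.powerset :=
      Multiset.one_le_count_iff_mem.2 (Multiset.mem_powerset.2 (Multiset.le_sum_of_mem ha))
    rw [Multiset.count_nsmul]
    calc π.count a ≤ π.card := Multiset.count_le_card _ _
      _ ≤ π.sum.card * 1 := by omega
      _ ≤ _ := Nat.mul_le_mul_left _ h2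
  · simp [Multiset.count_eq_zero_of_notMem ha]

/-- `m̃(π)`: the partition of `ℓ(π)` formed by the multiplicities of the multisets in `π`. -/
def multiplicityPartition (π : Multiset (Multiset ℕ)) : YoungDiagram :=
  ofParts (π.dedup.map fun s => π.count s)

lemma card_multiplicityPartition (π : Multiset (Multiset ℕ)) :
    (multiplicityPartition π).card = π.card := by
  rw [multiplicityPartition, card_ofParts]
  exact Multiset.toFinset_sum_count_eq π

/-- The multiset `{1^{μ_1}, 2^{μ_2}, …}` (with labels starting from `0`). -/
def contentOf (μ : YoungDiagram) : Multiset ℕ := μ.cells.val.map Prod.fst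

/-! ### The induced trivial character basis and the irreducible character basis -/

/-- The induced trivial character basis `h̃_μ`, defined by the recursion
`h_μ = ∑_π h̃_{m̃(π)}` over the multiset partitions `π` of `{1^{μ_1}, 2^{μ_2}, …}`: the only
`π` with `|m̃(π)| = ℓ(π) ≥ |μ|` is the one into singletons, for which `m̃(π) = μ`. -/
noncomputable def inducedTrivial (μ : YoungDiagram) : SymF :=
  completeHProd μ -
    ∑ π : {π // π ∈ (multisetPartitions (contentOf μ)).filter fun π => π.card < μ.card},
      inducedTrivial (multiplicityPartition π.1)
termination_by μ.card
decreasing_by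
  rw [card_multiplicityPartition]
  exact (Finset.mem_filter.1 π.2).2

/-- The irreducible character basis
`s̃_λ = ∑_{|μ| ≤ |λ|} K⁻¹_{(n-|λ|,λ),(n-|μ|,μ)} h̃_μ` with `n = 2|λ|`. -/
noncomputable def irreducible (lam : YoungDiagram) : SymF :=
  ∑ m ∈ Finset.range (lam.card + 1), ∑ μ : m.Partition,
    inverseKostka ((2 * lam.card - lam.card) :: lam.rowLens) ((2 * lam.card - m) ::ₘ μ.parts) •
      inducedTrivial (ofParts μ.parts)

/-! ### Border strips -/

/-- The cells of `(r - |λ|, λ)`; the cell `(i, j)` is in row `i` and column `j`. -/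
def paddedCells (r : ℕ) (lam : YoungDiagram) : Finset (ℕ × ℕ) :=
  YoungDiagram.cellsOfRowLens ((r - lam.card) :: lam.rowLens)

/-- Two cells share an edge. -/
def Adjacent (a b : ℕ × ℕ) : Prop :=
  (a.1 = b.1 ∧ (a.2 + 1 = b.2 ∨ b.2 + 1 = a.2)) ∨ (a.2 = b.2 ∧ (a.1 + 1 = b.1 ∨ b.1 + 1 = a.1))

/-- A set of `d` cells which is connected and contains no `2 × 2` square. -/
def IsBorderStrip (d : ℕ) (S : Finset (ℕ × ℕ)) : Prop :=
  S.card = d ∧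
  (∀ a ∈ S, ∀ b ∈ S, Relation.ReflTransGen (fun x y => x ∈ S ∧ y ∈ S ∧ Adjacent x y) a b) ∧
  ¬ ∃ i j, (i, j) ∈ S ∧ (i + 1, j) ∈ S ∧ (i, j + 1) ∈ S ∧ (i + 1, j + 1) ∈ S

/-- The cells of the skew diagram `(r - |λ|, λ) / (r - d - |α|, α)`. -/
def skewCells (r d : ℕ) (lam α : YoungDiagram) : Finset (ℕ × ℕ) :=
  paddedCells r lam \ paddedCells (r - d) α

/-- `λ // α` is a border strip of size `d`: the diagram of `(r - d - |α|, α)` is contained in that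
of `(r - |λ|, λ)` and the difference is a border strip of size `d`. -/
def IsDoubleSlashStrip (r d : ℕ) (lam α : YoungDiagram) : Prop :=
  paddedCells (r - d) α ⊆ paddedCells r lam ∧ IsBorderStrip d (skewCells r d lam α)

/-- The height of `λ // α`: the number of occupied rows minus `1`. -/
def height (r d : ℕ) (lam α : YoungDiagram) : ℕ :=
  ((skewCells r d lam α).image Prod.fst).card - 1

lemma cells_injective : Function.Injective YoungDiagram.cells := fun _ _ h => YoungDiagram.ext h

/-- The partitions whose diagram is contained in that of `λ`. -/
noncomputable def subpartitions (lam : YoungDiagram) : Finset YoungDiagram :=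
  lam.cells.powerset.preimage YoungDiagram.cells cells_injective.injOn

lemma mem_subpartitions {lam α : YoungDiagram} : α ∈ subpartitions lam ↔ α ≤ lam := by
  rw [subpartitions, Finset.mem_preimage, Finset.mem_powerset, YoungDiagram.cells_subset_iff]

lemma le_of_isDoubleSlashStrip {r d : ℕ} {lam α : YoungDiagram}
    (h : IsDoubleSlashStrip r d lam α) : α ≤ lam := by
  have key : ∀ (s : ℕ) (μ : YoungDiagram) (i j : ℕ),
      (i + 1, j) ∈ paddedCells s μ ↔ (i, j) ∈ μ := by
    intro s μ i j
    rw [paddedCells, YoungDiagram.mem_cellsOfRowLens]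
    conv_rhs => rw [← YoungDiagram.ofRowLens_to_rowLens_eq_self (μ := μ),
      YoungDiagram.mem_ofRowLens]
    simp
  rintro ⟨i, j⟩ hc
  exact (key r lam i j).1 (h.1 ((key (r - d) α i j).2 hc))

open Classical in
/-- `∑_{d ∣ k} ∑_α (-1)^{ht(λ//α) + ht(ν//α)}` over the partitions `α` for which both `λ // α`
and `ν // α` are border strips of size `d` (such an `α` is contained in `λ`). -/
noncomputable def coefficient (r k : ℕ) (lam ν : YoungDiagram) : ℚ :=
  ∑ d ∈ k.divisors, ∑ α ∈ subpartitions lam with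
      IsDoubleSlashStrip r d lam α ∧ IsDoubleSlashStrip r d ν α,
    (-1) ^ (height r d lam α + height r d ν α)

end IrrChar

namespace IrrChar

open MvPolynomial Finset

/-! ### Power sums and their adjoint derivations -/

/-! Let θ (`theta`) be the linear map `h_μ ↦ h̃_μ`. The rule for multiplying `s̃_λ` by `p_k` is
pulled back along θ to an identity between ordinary symmetric functions.

First, θ carries the operator `E_k = ∑_{d ∣ k} p_d (p_d^⊥ + 1)` to multiplication by `p_k`
(`theta_divisorOp`). Put `A_S = ∑_π h_{m̃(π)}`; the recursion defining `h̃` says `θ(A_S) = h_S`.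
Count the occurrences of a letter `a` part by part and apply Newton's identity to the multiplicity
of the part: `c_a(S) A_S = ∑_{m,d} c_a(m) p_d A_{S - dm}`. Replace `c_a(m)` by the number of `e ≥ 1`
with `a^e ⊆ m`, write `m = a^e + m'` and `k = de`; since `∑_{m'} A_{S' - dm'} = (p_d^⊥ + 1) A_{S'}`,
this becomes `c_a(S) A_S = ∑_k E_k A_{S - a^k}`. For a fresh letter of multiplicity `k`, comparison
with Newton's identity for `h_k` gives `θ(E_k A_S) = p_k h_S` by induction on `k`. The `A_S` are
unitriangular in the `h_μ`, so this suffices.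

Second, `s̃_λ = θ(D_λ)` (`theta_stableSchur`), where `D_λ` (`stableSchur`) is the Jacobi-Trudi
determinant of `(n - |λ|, λ)` with the first row replaced by ones.

Third, `p_d^⊥` subtracts `d` from one row index of `D_λ` at a time, and `p_d - 1` adds `d`
(`pSum_mul_betaDet`). Sorting the indices turns this into signed removal and addition of border
strips (`sum_remove_strips`, `sum_add_strips`). The remaining `1` in `p_d^⊥ + 1` and in `p_d = (p_d
- 1) + 1` is the horizontal strip at the end of the long first row. Hence `E_k D_λ` has the asserted
coefficients (`divisorOp_stableSchur`). -/

/-- The power sum `p_n`, indexed by a natural number `n > 0`. -/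
noncomputable def pSum (n : ℕ) : SymF := powerSum n.toPNat'

/-- The derivation `p_d^⊥ = d ∂/∂p_d`. -/
noncomputable def skewP (d : ℕ) : Derivation ℚ SymF SymF := (d : ℚ) • pderiv d.toPNat'

/-- The operator `∑_{d ∣ k} p_d (p_d^⊥ + 1)`. -/
noncomputable def divisorOp (k : ℕ) : SymF →ₗ[ℚ] SymF :=
  ∑ d ∈ k.divisors, LinearMap.mulLeft ℚ (pSum d) ∘ₗ ((skewP d : SymF →ₗ[ℚ] SymF) + LinearMap.id)

lemma divisorOp_apply (k : ℕ) (f : SymF) :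
    divisorOp k f = ∑ d ∈ k.divisors, pSum d * (skewP d f + f) := by
  simp [divisorOp]

lemma toPNat'_inj {d e : ℕ} (hd : 0 < d) (he : 0 < e) : d.toPNat' = e.toPNat' ↔ d = e := by
  refine ⟨fun h => ?_, fun h => h ▸ rfl⟩
  have := congrArg PNat.val h
  simpa [Nat.toPNat'_coe, hd, he] using this

lemma skewP_pSum {d e : ℕ} (hd : 0 < d) (he : 0 < e) :
    skewP d (pSum e) = if e = d then (d : SymF) else 0 := by
  by_cases h : e = d
  · subst h
    simp [skewP, pSum, powerSum, smul_eq_C_mul]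
  · rw [if_neg h, skewP, pSum, powerSum, Derivation.smul_apply, pderiv_X_of_ne, smul_zero]
    rwa [Ne, toPNat'_inj he hd]

/-- Newton's identities. -/
lemma newton (n : ℕ) : (n : SymF) * completeH n = ∑ i ∈ Icc 1 n, pSum i * completeH (n - i) := by
  rcases n with _ | n
  · simp
  have := completeH_succ n
  rw [map_add, map_natCast, C_1] at this
  rw [Nat.cast_succ, this, Fin.sum_univ_eq_sum_range
    (fun i => powerSum (Nat.succPNat i) * completeH (n - i))]
  refine Finset.sum_bij (fun i _ => i + 1) (by simp) (by simp) ?_ ?_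
  · intro b hb
    rw [mem_Icc] at hb
    exact ⟨b - 1, by simp; omega, by omega⟩
  · intro a _
    rw [Nat.add_sub_add_right]
    rfl

/-- Differentiate Newton's identity for `n h_n`. If `d ≤ n`, the factor `p_d` yields `d h_{n-d}`,
the other terms yield `(n - d) h_{n-d}` by induction and Newton again, and `n` cancels. -/
lemma skewP_completeH {d : ℕ} (hd : 0 < d) (n : ℕ) :
    skewP d (completeH n) = if d ≤ n then completeH (n - d) else 0 := by
  induction n using Nat.strong_induction_on with
  | _ n ih =>
    rcases Nat.eq_zero_or_pos n with rfl | hn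
    · rw [if_neg (by omega), completeH, Derivation.map_one_eq_zero]
    have h := congrArg (skewP d) (newton n)
    rw [Derivation.leibniz, Derivation.map_natCast, smul_zero, add_zero, map_sum] at h
    have hn0 : (n : SymF) ≠ 0 := by exact_mod_cast hn.ne'
    refine mul_left_cancel₀ hn0 ?_
    rw [smul_eq_mul] at h
    rw [h]
    have key : ∀ i ∈ Icc 1 n, skewP d (pSum i * completeH (n - i)) =
        (if i = d then (d : SymF) * completeH (n - d) else 0) +
          (if i ∈ Icc 1 (n - d) ∧ d ≤ n then pSum i * completeH (n - d - i) else 0) := by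
      intro i hi
      rw [mem_Icc] at hi
      rw [Derivation.leibniz, skewP_pSum hd hi.1, ih _ (by omega), add_comm, smul_eq_mul,
        smul_eq_mul]
      congr 1
      · split_ifs with h
        · subst h; ring
        · simp
      · simp only [mem_Icc]
        split_ifs with h1 h2 h2
        · rw [Nat.sub_right_comm]
        · omega
        · omega
        · simp
    rw [Finset.sum_congr rfl key, Finset.sum_add_distrib, Finset.sum_ite_eq']
    by_cases hdn : d ≤ n
    · simp only [hdn, and_true, if_true]
      rw [← Finset.sum_filter, if_pos (by simp; omega)]
      have : filter (fun i => i ∈ Icc 1 (n - d)) (Icc 1 n) = Icc 1 (n - d) := by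
        ext i; simp only [mem_filter, mem_Icc]; omega
      rw [this, ← newton, Nat.cast_sub hdn]
      ring
    · rw [if_neg (by simp; omega), if_neg hdn]
      simp [hdn]

lemma derivation_prod {ι : Type*} [DecidableEq ι] (D : Derivation ℚ SymF SymF) (s : Finset ι)
    (f : ι → SymF) : D (∏ i ∈ s, f i) = ∑ i ∈ s, (∏ j ∈ s.erase i, f j) * D (f i) := by
  induction s using Finset.induction_on with
  | empty => simp
  | insert a s ha ih =>
    rw [prod_insert ha, Derivation.leibniz, ih, sum_insert ha, erase_insert ha, add_comm,
      smul_eq_mul, smul_eq_mul, Finset.mul_sum]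
    congr 1
    refine Finset.sum_congr rfl fun i hi => ?_
    have hai : a ≠ i := fun h => ha (h ▸ hi)
    rw [erase_insert_of_ne hai, prod_insert (by simp [ha]), mul_assoc]

/-! ### Multiset partitions and their generating recursion -/

/-- `h_{m̃(π)}` as a product over the distinct multisets in `π`. -/
noncomputable def weight (π : Multiset (Multiset ℕ)) : SymF :=
  ∏ s ∈ π.toFinset, completeH (π.count s)

/-- `∑_π h_{m̃(π)}` over the multiset partitions of `S`. -/
noncomputable def partitionSum (S : Multiset ℕ) : SymF := ∑ π ∈ multisetPartitions S, weight π

lemma weight_eq_prod {π : Multiset (Multiset ℕ)} {T : Finset (Multiset ℕ)}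
    (h : π.toFinset ⊆ T) : weight π = ∏ s ∈ T, completeH (π.count s) := by
  refine Finset.prod_subset h fun s _ hs => ?_
  rw [Multiset.mem_toFinset] at hs
  rw [Multiset.count_eq_zero_of_notMem hs, completeH]

lemma weight_sub_replicate {π : Multiset (Multiset ℕ)} {T : Finset (Multiset ℕ)}
    (h : π.toFinset ⊆ T) {m : Multiset ℕ} (hm : m ∈ T) (k : ℕ) :
    weight (π - Multiset.replicate k m) =
      completeH (π.count m - k) * ∏ s ∈ T.erase m, completeH (π.count s) := by
  have h1 : (π - Multiset.replicate k m).toFinset ⊆ T := fun s hs => h (by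
    rw [Multiset.mem_toFinset] at hs ⊢
    exact Multiset.mem_of_le (Multiset.sub_le_self _ _) hs)
  rw [weight_eq_prod h1, ← Finset.mul_prod_erase _ _ hm]
  congr 1
  · rw [Multiset.count_sub, Multiset.count_replicate_self]
  · refine Finset.prod_congr rfl fun s hs => ?_
    rw [Multiset.count_sub, Multiset.count_replicate, if_neg (Finset.ne_of_mem_erase hs).symm,
      Nat.sub_zero]

lemma skewP_weight {d : ℕ} (hd : 0 < d) {π : Multiset (Multiset ℕ)} {T : Finset (Multiset ℕ)}
    (h : π.toFinset ⊆ T) : skewP d (weight π) =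
      ∑ m ∈ T, if d ≤ π.count m then weight (π - Multiset.replicate d m) else 0 := by
  rw [weight_eq_prod h, derivation_prod]
  refine Finset.sum_congr rfl fun m hm => ?_
  rw [skewP_completeH hd]
  split_ifs with h1
  · rw [weight_sub_replicate h hm, mul_comm]
  · rw [mul_zero]

/-- Newton's identity for the single factor `h_c`, `c` the multiplicity of `m`: lowering the index
by `k` removes `k` copies of `m`. -/
lemma count_mul_weight (π : Multiset (Multiset ℕ)) (m : Multiset ℕ) :
    (π.count m : SymF) * weight π = ∑ k ∈ Icc 1 (π.count m),
      pSum k * weight (π - Multiset.replicate k m) := by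
  have h : π.toFinset ⊆ insert m π.toFinset := Finset.subset_insert _ _
  have hm : m ∈ insert m π.toFinset := Finset.mem_insert_self _ _
  simp_rw [weight_sub_replicate h hm]
  rw [weight_eq_prod h, ← Finset.mul_prod_erase _ _ hm, ← mul_assoc, newton, Finset.sum_mul]
  simp_rw [mul_assoc]

/-- Removing `k` copies of `m` is a bijection onto the multiset partitions of `S - k • m`; putting
them back is legitimate because `m` is nonempty. -/
lemma sum_sub_replicate (g : Multiset (Multiset ℕ) → SymF) {S m : Multiset ℕ} (hm : m ≠ 0)
    (k : ℕ) : (∑ π ∈ multisetPartitions S,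
        if k ≤ π.count m then g (π - Multiset.replicate k m) else 0) =
      if k • m ≤ S then ∑ π ∈ multisetPartitions (S - k • m), g π else 0 := by
  split_ifs with h
  · rw [← Finset.sum_filter]
    refine Finset.sum_bij' (fun π _ => π - Multiset.replicate k m)
      (fun π _ => π + Multiset.replicate k m) ?_ ?_ ?_ ?_ ?_
    · intro π hπ
      rw [mem_filter, mem_multisetPartitions] at hπ
      obtain ⟨⟨h0, hS⟩, hk⟩ := hπ
      have hle := Multiset.le_count_iff_replicate_le.1 hk
      rw [mem_multisetPartitions]
      refine ⟨fun h0' => h0 (Multiset.mem_of_le (Multiset.sub_le_self _ _) h0'), ?_⟩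
      have : (π - Multiset.replicate k m).sum + k • m = S := by
        rw [← Multiset.sum_replicate, ← Multiset.sum_add, Multiset.sub_add_cancel hle, hS]
      rw [← this, Multiset.add_sub_cancel_right]
    · intro π hπ
      rw [mem_multisetPartitions] at hπ
      rw [mem_filter, mem_multisetPartitions]
      refine ⟨⟨?_, ?_⟩, ?_⟩
      · rw [Multiset.mem_add, not_or]
        exact ⟨hπ.1, fun h0 => hm (Multiset.eq_of_mem_replicate h0).symm⟩
      · rw [Multiset.sum_add, hπ.2, Multiset.sum_replicate, Multiset.sub_add_cancel h]
      · rw [Multiset.count_add, Multiset.count_replicate_self]; omega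
    · intro π hπ
      rw [mem_filter] at hπ
      exact Multiset.sub_add_cancel (Multiset.le_count_iff_replicate_le.1 hπ.2)
    · intro π _
      exact Multiset.add_sub_cancel_right
    · intros; rfl
  · refine Finset.sum_eq_zero fun π hπ => if_neg fun hk => h ?_
    rw [mem_multisetPartitions] at hπ
    have hle := Multiset.le_count_iff_replicate_le.1 hk
    rw [← hπ.2, ← Multiset.sub_add_cancel hle, Multiset.sum_add, Multiset.sum_replicate]
    exact Multiset.le_add_left _ _

/-- The nonempty submultisets of `S` contain every part of a multiset partition of `S`. -/
lemma toFinset_subset_powerset {S : Multiset ℕ} {π : Multiset (Multiset ℕ)}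
    (hπ : π ∈ multisetPartitions S) : π.toFinset ⊆ S.powerset.toFinset.erase 0 := by
  rw [mem_multisetPartitions] at hπ
  intro m hm
  rw [Multiset.mem_toFinset] at hm
  rw [mem_erase, Multiset.mem_toFinset, Multiset.mem_powerset]
  exact ⟨fun h => hπ.1 (h ▸ hm), hπ.2 ▸ Multiset.le_sum_of_mem hm⟩

/-- By the Leibniz rule `p_d^⊥` removes `d` copies of one nonempty part `m`. The extra summand `A_S`
is exactly the term of the empty `m`. -/
lemma skewP_add_self_partitionSum {d : ℕ} (hd : 0 < d) (S : Multiset ℕ) :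
    skewP d (partitionSum S) + partitionSum S =
      ∑ m ∈ S.powerset.toFinset, if d • m ≤ S then partitionSum (S - d • m) else 0 := by
  have h0 : 0 ∈ S.powerset.toFinset := by simp
  rw [← Finset.sum_erase_add _ _ h0]
  congr 1
  · rw [partitionSum, map_sum, Finset.sum_congr rfl fun π hπ =>
      skewP_weight hd (toFinset_subset_powerset hπ), Finset.sum_comm]
    refine Finset.sum_congr rfl fun m hm => ?_
    rw [sum_sub_replicate _ (Finset.ne_of_mem_erase hm)]
    rfl
  · simp

/-- In every `π` the letter `a` occurs `∑_m c_m(π) c_a(m)` times, and `count_mul_weight` absorbs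
each multiplicity `c_m(π)`. -/
lemma count_mul_partitionSum (a : ℕ) (S : Multiset ℕ) :
    (S.count a : SymF) * partitionSum S =
      ∑ m ∈ S.powerset.toFinset, ∑ k ∈ Icc 1 S.card,
        if k • m ≤ S then (m.count a : SymF) * (pSum k * partitionSum (S - k • m)) else 0 := by
  have h0 : 0 ∈ S.powerset.toFinset := by simp
  rw [← Finset.sum_erase_add _ _ h0]
  have h1 : ∀ π ∈ multisetPartitions S, (S.count a : SymF) * weight π =
      ∑ m ∈ S.powerset.toFinset.erase 0, ∑ k ∈ Icc 1 S.card, (m.count a : SymF) * (pSum k *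
        if k ≤ π.count m then weight (π - Multiset.replicate k m) else 0) := by
    intro π hπ
    have hsub := toFinset_subset_powerset hπ
    have hπ' := mem_multisetPartitions.1 hπ
    have hc : S.count a = ∑ m ∈ S.powerset.toFinset.erase 0, π.count m * m.count a := by
      have hs : S.count a = (π.map (Multiset.count a)).sum := by
        conv_lhs => rw [← hπ'.2]
        exact map_multiset_sum (Multiset.countAddMonoidHom a) π
      rw [hs, Finset.sum_multiset_map_count]
      refine Finset.sum_subset hsub fun m _ hm => ?_
      rw [Multiset.mem_toFinset] at hm
      rw [Multiset.count_eq_zero_of_notMem hm, zero_smul]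
    rw [hc, Nat.cast_sum, Finset.sum_mul]
    refine Finset.sum_congr rfl fun m hm => ?_
    rw [Nat.cast_mul, mul_right_comm, count_mul_weight, mul_comm, Finset.mul_sum]
    -- This bound permits a range of `k` independent of `π`, so that the sums can be exchanged.
    have hle : π.count m ≤ S.card := by
      have h1 : π.count m • m ≤ S := by
        rw [← hπ'.2, ← Multiset.sum_replicate]
        obtain ⟨ρ, hρ⟩ := Multiset.le_iff_exists_add.1
          (Multiset.le_count_iff_replicate_le.1 (le_refl (π.count m)))
        conv_rhs => rw [hρ]
        rw [Multiset.sum_add]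
        exact Multiset.le_add_right _ _
      have h2 := Multiset.card_le_card h1
      have h3 : 1 ≤ m.card := Multiset.card_pos.2 (Finset.ne_of_mem_erase hm)
      rw [Multiset.card_nsmul] at h2
      calc π.count m = π.count m * 1 := (mul_one _).symm
        _ ≤ _ := (Nat.mul_le_mul_left _ h3).trans h2
    refine Finset.sum_subset_zero_on_sdiff (Finset.Icc_subset_Icc_right hle) ?_ ?_
    · intro k hk
      rw [mem_sdiff, mem_Icc, mem_Icc] at hk
      rw [if_neg (by omega)]
      simp
    · intro k hk
      rw [mem_Icc] at hk
      rw [if_pos hk.2]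
  rw [partitionSum, Finset.mul_sum, Finset.sum_congr rfl h1, Finset.sum_comm]
  simp only [Multiset.count_zero, Nat.cast_zero, zero_mul, ite_self, Finset.sum_const_zero,
    add_zero]
  refine Finset.sum_congr rfl fun m hm => ?_
  rw [Finset.sum_comm]
  refine Finset.sum_congr rfl fun k _ => ?_
  rw [← Finset.mul_sum, ← Finset.mul_sum, sum_sub_replicate _ (Finset.ne_of_mem_erase hm)]
  split_ifs
  · rfl
  · simp

/-- The recursion `c_a(S) A_S = ∑_k E_k A_{S - a^k}` for the sums over multiset partitions. -/
lemma count_mul_partitionSum_eq_sum_divisorOp (a : ℕ) (S : Multiset ℕ) :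
    (S.count a : SymF) * partitionSum S =
      ∑ k ∈ Icc 1 (S.count a), divisorOp k (partitionSum (S - Multiset.replicate k a)) := by
  -- The value is zero when `d • m` does not fit into `S`, so ranges of summation can be enlarged
  -- freely.
  set F : ℕ → Multiset ℕ → SymF := fun d m =>
    if d • m ≤ S then pSum d * partitionSum (S - d • m) else 0 with hF
  have hcard : S.count a ≤ S.card := Multiset.count_le_card _ _
  have hle : ∀ (d : ℕ) (m : Multiset ℕ), 0 < d → d • m ≤ S → m ≤ S := fun d m hd h =>
    le_trans (by
      obtain ⟨d, rfl⟩ := Nat.exists_eq_succ_of_ne_zero hd.ne'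
      rw [succ_nsmul]; exact Multiset.le_add_left _ _) h
  -- Removing `a^k` and then `d` copies of `m` amounts to removing `d` copies of `a^{k/d} + m`.
  have hR : ∀ k ∈ Icc 1 (S.count a), divisorOp k (partitionSum (S - Multiset.replicate k a)) =
      ∑ d ∈ k.divisors, ∑ m ∈ S.powerset.toFinset, F d (Multiset.replicate (k / d) a + m) := by
    intro k hk
    rw [mem_Icc] at hk
    rw [divisorOp_apply]
    refine Finset.sum_congr rfl fun d hd => ?_
    rw [Nat.mem_divisors] at hd
    have hd0 : 0 < d := Nat.pos_of_dvd_of_pos hd.1 hk.1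
    have hkd : d * (k / d) = k := Nat.mul_div_cancel' hd.1
    have hrep : Multiset.replicate k a ≤ S := Multiset.le_count_iff_replicate_le.1 hk.2
    rw [skewP_add_self_partitionSum hd0, Finset.mul_sum]
    have hadd : ∀ m : Multiset ℕ, d • (Multiset.replicate (k / d) a + m) =
        Multiset.replicate k a + d • m := by
      intro m
      rw [nsmul_add, Multiset.nsmul_replicate, hkd]
    refine Finset.sum_subset_zero_on_sdiff ?_ ?_ ?_
    · intro m hm
      rw [Multiset.mem_toFinset, Multiset.mem_powerset] at hm ⊢
      exact hm.trans (Multiset.sub_le_self _ _)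
    · intro m hm
      rw [mem_sdiff, Multiset.mem_toFinset, Multiset.mem_powerset, Multiset.mem_toFinset,
        Multiset.mem_powerset] at hm
      simp only [hF, hadd]
      refine if_neg fun h => hm.2 ?_
      have h1 : d • m ≤ S - Multiset.replicate k a := by
        rw [add_comm] at h
        exact (le_tsub_iff_right hrep).2 h
      refine le_trans ?_ h1
      obtain ⟨d', rfl⟩ := Nat.exists_eq_succ_of_ne_zero hd0.ne'
      rw [succ_nsmul]; exact Multiset.le_add_left _ _
    · intro m _
      simp only [hF, hadd]
      have : Multiset.replicate k a + d • m ≤ S ↔ d • m ≤ S - Multiset.replicate k a := by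
        rw [add_comm]; exact (le_tsub_iff_right hrep).symm
      simp only [this]
      split_ifs
      · rw [tsub_add_eq_tsub_tsub]
      · simp
  have hde : ∀ d ∈ Icc 1 S.card, ∀ e : ℕ,
      ∑ m ∈ S.powerset.toFinset, F d (Multiset.replicate e a + m) =
        ∑ m ∈ S.powerset.toFinset, if e ≤ m.count a then F d m else 0 := by
    intro d hd e
    rw [mem_Icc] at hd
    rw [← Finset.sum_filter (fun m => e ≤ Multiset.count a m)]
    refine Finset.sum_bij_ne_zero (fun m _ _ => Multiset.replicate e a + m) ?_ ?_ ?_ ?_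
    · intro m _ h
      have h1 := (ite_ne_right_iff.1 h).1
      rw [mem_filter, Multiset.mem_toFinset, Multiset.mem_powerset]
      exact ⟨hle d _ hd.1 h1, by rw [Multiset.count_add, Multiset.count_replicate_self]; omega⟩
    · intro m _ _ m' _ _ h
      exact add_left_cancel h
    · intro m hm h
      rw [mem_filter, Multiset.mem_toFinset, Multiset.mem_powerset] at hm
      have hr := Multiset.le_count_iff_replicate_le.1 hm.2
      have : Multiset.replicate e a + (m - Multiset.replicate e a) = m := by
        rw [add_comm]; exact Multiset.sub_add_cancel hr
      refine ⟨m - Multiset.replicate e a, ?_, by rwa [this], this⟩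
      rw [Multiset.mem_toFinset, Multiset.mem_powerset]
      exact (Multiset.sub_le_self _ _).trans hm.1
    · intros; rfl
  rw [count_mul_partitionSum, Finset.sum_congr rfl hR, Finset.sum_comm]
  -- The factor `c_a(m)` is the number of `e ≥ 1` with `a^e ⊆ m`.
  have hL : ∀ d ∈ Icc 1 S.card, (∑ m ∈ S.powerset.toFinset, if d • m ≤ S then
      (m.count a : SymF) * (pSum d * partitionSum (S - d • m)) else 0) =
      ∑ e ∈ Icc 1 S.card, ∑ m ∈ S.powerset.toFinset, F d (Multiset.replicate e a + m) := by
    intro d hd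
    rw [Finset.sum_congr rfl fun e _ => hde d hd e, Finset.sum_comm]
    refine Finset.sum_congr rfl fun m hm => ?_
    rw [Multiset.mem_toFinset, Multiset.mem_powerset] at hm
    rw [← Finset.sum_filter]
    have : filter (fun e => e ≤ m.count a) (Icc 1 S.card) = Icc 1 (m.count a) := by
      have := (Multiset.count_le_card a m).trans (Multiset.card_le_card hm)
      ext e; simp only [mem_filter, mem_Icc]; omega
    rw [this, Finset.sum_const, Nat.card_Icc, Nat.add_sub_cancel, nsmul_eq_mul]
    simp only [hF]
    split_ifs <;> simp
  rw [Finset.sum_congr rfl hL, ← Finset.sum_product',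
    Finset.sum_sigma' (Icc 1 (S.count a)) fun k => k.divisors]
  symm
  -- The pairs `d ∣ k` correspond to factorisations `k = d e`; pairs with `d e > c_a(S)` contribute
  -- zero.
  refine Finset.sum_bij_ne_zero (fun x _ _ => (x.2, x.1 / x.2)) ?_ ?_ ?_ ?_
  · rintro ⟨k, d⟩ hx _
    simp only [mem_sigma, mem_Icc, Nat.mem_divisors, mem_product] at hx ⊢
    have hd0 : 0 < d := Nat.pos_of_dvd_of_pos hx.2.1 hx.1.1
    have h1 := Nat.le_of_dvd hx.1.1 hx.2.1
    have h2 := Nat.div_le_self k d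
    have h3 := Nat.div_pos h1 hd0
    omega
  · rintro ⟨k, d⟩ hx _ ⟨k', d'⟩ hx' _ h
    simp only [mem_sigma, mem_Icc, Nat.mem_divisors, Prod.mk.injEq] at hx hx' h
    obtain ⟨rfl, h⟩ := h
    have h1 := Nat.mul_div_cancel' hx.2.1
    have h2 := Nat.mul_div_cancel' hx'.2.1
    rw [h, h2] at h1
    rw [h1]
  · rintro ⟨d, e⟩ hx h
    simp only [mem_product, mem_Icc] at hx
    have hd0 : 0 < d := hx.1.1
    obtain ⟨m, _, hm⟩ := Finset.exists_ne_zero_of_sum_ne_zero h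
    have h1 := (ite_ne_right_iff.1 hm).1
    have h2 := Multiset.count_le_of_le a h1
    rw [Multiset.count_nsmul, Multiset.count_add, Multiset.count_replicate_self] at h2
    have h3 : d * e ≤ S.count a := (Nat.mul_le_mul_left d (Nat.le_add_right e _)).trans h2
    have h4 : 0 < d * e := Nat.mul_pos hd0 hx.2.1
    have h5 : d * e / d = e := Nat.mul_div_cancel_left e hd0
    refine ⟨⟨d * e, d⟩, ?_, ?_, ?_⟩
    · simp only [mem_sigma, mem_Icc, Nat.mem_divisors]
      exact ⟨⟨h4, h3⟩, Dvd.intro _ rfl, h4.ne'⟩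
    · simpa only [h5] using h
    · simp only [h5]
  · intros; rfl

/-! ### The linear map `h_μ ↦ h̃_μ` -/

lemma ofParts_zero_cons (m : Multiset ℕ) : ofParts (0 ::ₘ m) = ofParts m := by
  have hs : (0 ::ₘ m).sort (· ≥ ·) = m.sort (· ≥ ·) ++ [0] := by
    refine List.Perm.eq_of_pairwise' (r := (· ≥ ·)) (Multiset.pairwise_sort _ _) ?_ ?_
    · rw [List.pairwise_append]
      exact ⟨Multiset.pairwise_sort _ _, by simp, by simp⟩
    · rw [← Multiset.coe_eq_coe, Multiset.sort_eq, ← Multiset.coe_add, Multiset.sort_eq,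
        Multiset.coe_singleton, add_comm, Multiset.singleton_add]
  ext c
  rw [YoungDiagram.mem_cells, YoungDiagram.mem_cells, ofParts, ofParts, YoungDiagram.mem_ofRowLens,
    YoungDiagram.mem_ofRowLens]
  simp only [hs]
  constructor
  · rintro ⟨h, hc⟩
    rw [List.getElem_append] at hc
    split_ifs at hc with h1
    · exact ⟨h1, hc⟩
    · simp at hc
  · rintro ⟨h, hc⟩
    exact ⟨by rw [List.length_append]; omega, by rwa [List.getElem_append_left h]⟩

lemma ofParts_filter_pos (m : Multiset ℕ) : ofParts (m.filter (0 < ·)) = ofParts m := by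
  have h : ∀ (k : ℕ) (m : Multiset ℕ), ofParts (m + Multiset.replicate k 0) = ofParts m := by
    intro k m
    induction k with
    | zero => simp
    | succ k ih => rw [Multiset.replicate_succ, Multiset.add_cons, ofParts_zero_cons, ih]
  conv_rhs => rw [← Multiset.filter_add_not (0 < ·) m]
  have : m.filter (fun a => ¬ 0 < a) = Multiset.replicate (m.filter fun a => ¬ 0 < a).card 0 :=
    Multiset.eq_replicate_card.2 fun b hb => by
      have := (Multiset.mem_filter.1 hb).2; omega
  rw [this, h]

lemma rowLens_ofParts (m : Multiset ℕ) :
    ((ofParts m).rowLens : Multiset ℕ) = m.filter (0 < ·) := by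
  rw [← ofParts_filter_pos, ofParts, YoungDiagram.rowLens_ofRowLens_eq_self, Multiset.sort_eq]
  intro x hx
  rw [Multiset.mem_sort] at hx
  exact (Multiset.mem_filter.1 hx).2

lemma ofParts_rowLens (μ : YoungDiagram) : ofParts (μ.rowLens : Multiset ℕ) = μ := by
  conv_rhs => rw [← YoungDiagram.ofRowLens_to_rowLens_eq_self (μ := μ)]
  have : (μ.rowLens : Multiset ℕ).sort (· ≥ ·) = μ.rowLens :=
    List.Perm.eq_of_pairwise' (r := (· ≥ ·)) (Multiset.pairwise_sort _ _)
      μ.rowLens_sorted.pairwise (by rw [← Multiset.coe_eq_coe, Multiset.sort_eq])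
  simp only [ofParts, this]

/-- The product of the `h_a` over the elements of a multiset. -/
noncomputable def hProd (m : Multiset ℕ) : SymF := (m.map completeH).prod

lemma hProd_filter_pos (m : Multiset ℕ) : hProd (m.filter (0 < ·)) = hProd m := by
  induction m using Multiset.induction_on with
  | empty => rfl
  | cons a m ih =>
    rcases Nat.eq_zero_or_pos a with rfl | ha
    · rw [Multiset.filter_cons_of_neg _ (by simp), ih]
      simp [hProd, completeH]
    · rw [Multiset.filter_cons_of_pos (p := (0 < ·)) _ ha, hProd, Multiset.map_cons, Multiset.prod_cons]
      rw [hProd] at ih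
      rw [ih]
      simp [hProd]

lemma completeHProd_eq (μ : YoungDiagram) : completeHProd μ = hProd μ.rowLens := by
  simp [completeHProd, hProd]

lemma completeHProd_ofParts (m : Multiset ℕ) : completeHProd (ofParts m) = hProd m := by
  rw [completeHProd_eq, rowLens_ofParts, hProd_filter_pos]

lemma equivH_symm_completeH (n : ℕ) :
    equivH.symm (completeH n) = if n = 0 then 1 else X (Nat.toPNat' n) := toH_completeH n

lemma hExponent_cons (a : ℕ) (m : Multiset ℕ) : hExponent (a ::ₘ m) =
    (if a = 0 then 0 else Finsupp.single (Nat.toPNat' a) 1) + hExponent m := by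
  rcases Nat.eq_zero_or_pos a with rfl | ha
  · rw [hExponent, Multiset.filter_cons_of_neg _ (by simp)]
    simp [hExponent]
  · rw [hExponent, Multiset.filter_cons_of_pos (p := (0 < ·)) _ ha, if_neg ha.ne']
    simp [hExponent]

lemma equivH_symm_hProd (m : Multiset ℕ) :
    equivH.symm (hProd m) = monomial (hExponent m) 1 := by
  induction m using Multiset.induction_on with
  | empty => simp [hProd, hExponent]
  | cons a m ih =>
    rw [hProd, Multiset.map_cons, Multiset.prod_cons, map_mul, ← hProd, ih, hExponent_cons,
      equivH_symm_completeH]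
    split_ifs
    · simp
    · rw [X, monomial_mul, one_mul]

/-- The multiset of positive numbers with the given exponent vector. -/
noncomputable def exponentParts (e : ℕ+ →₀ ℕ) : Multiset ℕ :=
  (Finsupp.toMultiset e).map fun k : ℕ+ => (k : ℕ)

lemma exponentParts_hExponent (m : Multiset ℕ) :
    exponentParts (hExponent m) = m.filter (0 < ·) := by
  induction m using Multiset.induction_on with
  | empty => simp [exponentParts, hExponent]
  | cons a m ih =>
    rw [exponentParts] at ih ⊢
    rw [hExponent_cons, map_add, Multiset.map_add, ih]
    rcases Nat.eq_zero_or_pos a with rfl | ha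
    · rw [Multiset.filter_cons_of_neg _ (by simp)]
      simp
    · rw [Multiset.filter_cons_of_pos (p := (0 < ·)) _ ha, if_neg ha.ne', Finsupp.toMultiset_single, one_smul,
        Multiset.map_singleton, Multiset.singleton_add, Nat.toPNat'_coe, if_pos ha]

lemma hExponent_exponentParts (e : ℕ+ →₀ ℕ) : hExponent (exponentParts e) = e := by
  rw [exponentParts, hExponent, Multiset.filter_eq_self.2, Multiset.map_map]
  · simp only [Function.comp_def, PNat.coe_toPNat']
    refine Function.LeftInverse.injective Finsupp.toMultiset_toFinsupp ?_
    rw [map_multiset_sum, Multiset.map_map]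
    simp
  · intro a ha
    obtain ⟨b, _, rfl⟩ := Multiset.mem_map.1 ha
    exact b.pos

/-- The linear map that sends `h_μ` to `h̃_μ`. -/
noncomputable def theta : SymF →ₗ[ℚ] SymF :=
  ((basisMonomials ℕ+ ℚ).constr ℚ fun e => inducedTrivial (ofParts (exponentParts e))) ∘ₗ
    equivH.symm.toLinearMap

lemma theta_hProd (m : Multiset ℕ) : theta (hProd m) = inducedTrivial (ofParts m) := by
  rw [theta, LinearMap.comp_apply, AlgEquiv.toLinearMap_apply, equivH_symm_hProd]
  have := (basisMonomials ℕ+ ℚ).constr_basis ℚ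
    (fun e => inducedTrivial (ofParts (exponentParts e))) (hExponent m)
  rw [coe_basisMonomials] at this
  rw [this, exponentParts_hExponent, ofParts_filter_pos]

/-- `equivH` carries the monomial basis to the products of the `h_a`. -/
lemma linearMap_ext_hProd {f g : SymF →ₗ[ℚ] SymF} (h : ∀ m, f (hProd m) = g (hProd m)) :
    f = g := by
  have : f ∘ₗ equivH.toLinearMap = g ∘ₗ equivH.toLinearMap := by
    refine (basisMonomials ℕ+ ℚ).ext fun e => ?_
    have h1 : equivH (basisMonomials ℕ+ ℚ e) = hProd (exponentParts e) := by
      rw [← equivH.apply_symm_apply (hProd _), equivH_symm_hProd, hExponent_exponentParts,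
        coe_basisMonomials]
    rw [LinearMap.comp_apply, LinearMap.comp_apply, AlgEquiv.toLinearMap_apply, h1, h]
  refine LinearMap.ext fun x => ?_
  have := LinearMap.congr_fun this (equivH.symm x)
  simpa using this

/-! ### The images of the sums over multiset partitions -/

/-- `h_S = ∏_a h_{c_a(S)}`. -/
noncomputable def hContent (S : Multiset ℕ) : SymF := ∏ a ∈ S.toFinset, completeH (S.count a)

lemma weight_eq_completeHProd (π : Multiset (Multiset ℕ)) :
    weight π = completeHProd (multiplicityPartition π) := by
  rw [multiplicityPartition, completeHProd_ofParts, hProd, Multiset.map_map]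
  rfl

lemma theta_weight (π : Multiset (Multiset ℕ)) :
    theta (weight π) = inducedTrivial (multiplicityPartition π) := by
  rw [weight_eq_completeHProd, multiplicityPartition, completeHProd_ofParts, theta_hProd]

lemma card_le_card_sum {π : Multiset (Multiset ℕ)} (h : 0 ∉ π) : π.card ≤ π.sum.card := by
  induction π using Multiset.induction_on with
  | empty => simp
  | cons b π ih =>
    rw [Multiset.mem_cons, not_or] at h
    have hb := Multiset.card_pos.2 (Ne.symm h.1)
    have := ih h.2
    rw [Multiset.sum_cons, Multiset.card_add, Multiset.card_cons]
    omega

/-- Each part has at least one element, so as many parts as elements forces every part to be a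
singleton. -/
lemma eq_map_singleton {π : Multiset (Multiset ℕ)} (h : 0 ∉ π) (hc : π.sum.card ≤ π.card) :
    π = π.sum.map fun a => {a} := by
  induction π using Multiset.induction_on with
  | empty => simp
  | cons b π ih =>
    rw [Multiset.mem_cons, not_or] at h
    have hb := Multiset.card_pos.2 (Ne.symm h.1)
    have := card_le_card_sum h.2
    rw [Multiset.sum_cons, Multiset.card_add, Multiset.card_cons] at hc
    obtain ⟨x, rfl⟩ := Multiset.card_eq_one.1 (show b.card = 1 by omega)
    rw [Multiset.sum_cons, Multiset.map_add, ← ih h.2 (by omega), Multiset.map_singleton,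
      Multiset.singleton_add]

lemma multisetPartitions_filter_not_lt (S : Multiset ℕ) :
    (multisetPartitions S).filter (fun π => ¬ π.card < S.card) = {S.map fun a => {a}} := by
  ext π
  rw [mem_filter, mem_multisetPartitions, mem_singleton, not_lt]
  constructor
  · rintro ⟨⟨h0, rfl⟩, hc⟩
    exact eq_map_singleton h0 hc
  · rintro rfl
    refine ⟨⟨?_, Multiset.sum_map_singleton S⟩, by rw [Multiset.card_map]⟩
    rw [Multiset.mem_map]
    rintro ⟨a, _, ha⟩
    exact Multiset.singleton_ne_zero a ha

lemma count_contentOf (μ : YoungDiagram) (i : ℕ) : (contentOf μ).count i = μ.rowLen i := by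
  rw [contentOf, Multiset.count_map, YoungDiagram.rowLen_eq_card, YoungDiagram.row]
  simp only [eq_comm (a := i)]
  rfl

lemma card_contentOf (μ : YoungDiagram) : (contentOf μ).card = μ.card := by
  rw [contentOf, Multiset.card_map]; rfl

lemma rowLen_pos_iff {μ : YoungDiagram} {i : ℕ} : 0 < μ.rowLen i ↔ i < μ.colLen 0 := by
  rw [← YoungDiagram.mem_iff_lt_rowLen, YoungDiagram.mem_iff_lt_colLen]

lemma toFinset_contentOf (μ : YoungDiagram) : (contentOf μ).toFinset = range (μ.colLen 0) := by
  ext i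
  rw [Multiset.mem_toFinset, ← Multiset.count_pos, count_contentOf, rowLen_pos_iff, mem_range]

lemma map_count_contentOf (μ : YoungDiagram) :
    (contentOf μ).dedup.map (fun a => (contentOf μ).count a) = μ.rowLens := by
  rw [← Multiset.toFinset_val, toFinset_contentOf]
  simp only [count_contentOf]
  rfl

lemma hContent_contentOf (μ : YoungDiagram) : hContent (contentOf μ) = completeHProd μ := by
  rw [completeHProd_eq, ← map_count_contentOf, hProd, Multiset.map_map]
  rfl

lemma multiplicityPartition_map_singleton (S : Multiset ℕ) :
    multiplicityPartition (S.map fun a => {a}) = ofParts (S.dedup.map fun a => S.count a) := by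
  have hinj : Function.Injective fun a : ℕ => ({a} : Multiset ℕ) := fun a b h => Multiset.singleton_inj.1 h
  rw [multiplicityPartition, ← Multiset.dedup_map_dedup_eq,
    (Multiset.Nodup.map hinj (Multiset.nodup_dedup S)).dedup, Multiset.map_map]
  congr 1
  refine Multiset.map_congr rfl fun a _ => ?_
  exact Multiset.count_map_eq_count' _ _ hinj a

/-- This is the recursion defining `h̃`: the partition into singletons contributes `h̃_μ`, and the
coarser ones cancel the sum subtracted in `inducedTrivial`. -/
lemma theta_partitionSum_contentOf (μ : YoungDiagram) :
    theta (partitionSum (contentOf μ)) = completeHProd μ := by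
  rw [partitionSum, map_sum, Finset.sum_congr rfl fun π _ => theta_weight π,
    ← Finset.sum_filter_add_sum_filter_not _ fun π => π.card < (contentOf μ).card,
    multisetPartitions_filter_not_lt, sum_singleton, multiplicityPartition_map_singleton,
    map_count_contentOf, ofParts_rowLens, card_contentOf]
  conv_lhs => rw [inducedTrivial]
  rw [← Finset.sum_coe_sort]
  ring

/-- Unitriangularity of the sums `A_S` with respect to the `h_μ`, which lets identities on the `A_S`
pass to all symmetric functions. -/
lemma partitionSum_contentOf (μ : YoungDiagram) : partitionSum (contentOf μ) = completeHProd μ +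
    ∑ π ∈ (multisetPartitions (contentOf μ)).filter fun π => π.card < μ.card,
      completeHProd (multiplicityPartition π) := by
  rw [partitionSum, Finset.sum_congr rfl fun π _ => weight_eq_completeHProd π,
    ← Finset.sum_filter_add_sum_filter_not _ fun π => π.card < (contentOf μ).card,
    multisetPartitions_filter_not_lt, sum_singleton, multiplicityPartition_map_singleton,
    map_count_contentOf, ofParts_rowLens, card_contentOf, add_comm]

/-! ### Relabelling -/

lemma weight_map {f : ℕ → ℕ} (hf : Function.Injective f) (π : Multiset (Multiset ℕ)) :
    weight (π.map (Multiset.map f)) = weight π := by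
  have hF := Multiset.map_injective hf
  rw [weight, Multiset.toFinset_map, Finset.prod_image hF.injOn]
  exact Finset.prod_congr rfl fun s _ => by rw [Multiset.count_map_eq_count' _ _ hF]

lemma hContent_map {f : ℕ → ℕ} (hf : Function.Injective f) (S : Multiset ℕ) :
    hContent (S.map f) = hContent S := by
  rw [hContent, Multiset.toFinset_map, Finset.prod_image hf.injOn]
  exact Finset.prod_congr rfl fun s _ => by rw [Multiset.count_map_eq_count' _ _ hf]

lemma partitionSum_map {f : ℕ → ℕ} (hf : Function.Injective f) (S : Multiset ℕ) :
    partitionSum (S.map f) = partitionSum S := by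
  have hF := Multiset.map_injective hf
  have hsum : ∀ π : Multiset (Multiset ℕ), (π.map (Multiset.map f)).sum = π.sum.map f := fun π =>
    (map_multiset_sum (Multiset.mapAddMonoidHom f) π).symm
  symm
  refine Finset.sum_bij (fun π _ => π.map (Multiset.map f)) ?_ ?_ ?_ ?_
  · intro π hπ
    rw [mem_multisetPartitions] at hπ ⊢
    refine ⟨?_, by rw [hsum, hπ.2]⟩
    rw [Multiset.mem_map]
    rintro ⟨s, hs, h⟩
    rw [Multiset.map_eq_zero] at h
    exact hπ.1 (h ▸ hs)
  · intro π _ π' _ h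
    exact Multiset.map_injective hF h
  · intro π hπ
    rw [mem_multisetPartitions] at hπ
    have hback : (π.map (Multiset.map (Function.invFun f))).map (Multiset.map f) = π := by
      rw [Multiset.map_map]
      conv_rhs => rw [← Multiset.map_id π]
      refine Multiset.map_congr rfl fun s hs => ?_
      rw [Function.comp_apply, Multiset.map_map, id_eq]
      conv_rhs => rw [← Multiset.map_id s]
      refine Multiset.map_congr rfl fun a ha => ?_
      have h1 : a ∈ S.map f := by
        rw [← hπ.2]
        exact Multiset.mem_of_le (Multiset.le_sum_of_mem hs) ha
      obtain ⟨b, _, rfl⟩ := Multiset.mem_map.1 h1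
      rw [Function.comp_apply, Function.leftInverse_invFun hf, id_eq]
    refine ⟨π.map (Multiset.map (Function.invFun f)), ?_, hback⟩
    rw [mem_multisetPartitions]
    refine ⟨?_, ?_⟩
    · intro h0
      refine hπ.1 ?_
      rw [← hback]
      exact Multiset.mem_map.2 ⟨0, h0, rfl⟩
    · apply Multiset.map_injective hf
      rw [← hsum, hback, hπ.2]
  · intro π _
    exact (weight_map hf π).symm

/-- List the letters of `S` by decreasing multiplicity. This reduces arbitrary multisets to those of
the form `contentOf μ`. -/
lemma exists_relabelling (S : Multiset ℕ) : ∃ (μ : YoungDiagram) (f : ℕ → ℕ),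
    Function.Injective f ∧ S = (contentOf μ).map f := by
  let r : ℕ → ℕ → Prop := fun a b => S.count b ≤ S.count a
  have : Std.Total r := ⟨fun a b => le_total _ _⟩
  have : IsTrans ℕ r := ⟨fun a b c h1 h2 => le_trans h2 h1⟩
  set l := S.dedup.toList.insertionSort r with hl
  have hlS : (l : Multiset ℕ) = S.dedup := by
    rw [hl, Multiset.coe_eq_coe.2 (List.perm_insertionSort r _), Multiset.coe_toList]
  have hmem : ∀ a, a ∈ l ↔ a ∈ S := fun a => by
    rw [← Multiset.mem_coe, hlS, Multiset.mem_dedup]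
  have hnd : l.Nodup := by rw [← Multiset.coe_nodup, hlS]; exact Multiset.nodup_dedup S
  have hsorted : (l.map fun a => S.count a).SortedGE := by
    refine List.Pairwise.sortedGE ?_
    rw [List.pairwise_map]
    exact List.pairwise_insertionSort r _
  set μ := YoungDiagram.ofRowLens _ hsorted with hμ
  have hrow : ∀ i (h : i < l.length), μ.rowLen i = S.count l[i] := fun i h => by
    have := YoungDiagram.rowLen_ofRowLens (hw := hsorted) ⟨i, by simpa using h⟩
    simpa using this
  have hlen : μ.colLen 0 = l.length := by
    rw [← YoungDiagram.length_rowLens, hμ, YoungDiagram.rowLens_ofRowLens_eq_self, List.length_map]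
    intro x hx
    obtain ⟨a, ha, rfl⟩ := List.mem_map.1 hx
    exact Multiset.count_pos.2 ((hmem a).1 ha)
  -- Every letter of `S` is at most `S.sum`, so the default values `S.sum + 1 + i` keep the map
  -- injective.
  let f : ℕ → ℕ := fun i => if h : i < l.length then l[i] else S.sum + 1 + i
  have hlt : ∀ i (h : i < l.length), l[i] ≤ S.sum := fun i h =>
    Multiset.le_sum_of_mem ((hmem _).1 (List.getElem_mem h))
  have hf : Function.Injective f := by
    intro i j hij
    simp only [f] at hij
    split_ifs at hij with h1 h2 h2
    · exact (hnd.getElem_inj_iff).1 hij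
    · have := hlt i h1; omega
    · have := hlt j h2; omega
    · omega
  refine ⟨μ, f, hf, ?_⟩
  ext a
  by_cases ha : a ∈ S
  · obtain ⟨i, hi, rfl⟩ := List.getElem_of_mem ((hmem a).2 ha)
    have hfi : f i = l[i] := dif_pos hi
    rw [← hrow i hi, ← hfi, Multiset.count_map_eq_count' _ _ hf, count_contentOf]
  · rw [Multiset.count_eq_zero_of_notMem ha, Multiset.count_eq_zero_of_notMem]
    intro h
    obtain ⟨i, hi, rfl⟩ := Multiset.mem_map.1 h
    rw [← Multiset.mem_toFinset, toFinset_contentOf, mem_range, hlen] at hi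
    refine ha ((hmem _).1 ?_)
    simp only [f, dif_pos hi]
    exact List.getElem_mem hi

lemma theta_partitionSum (S : Multiset ℕ) : theta (partitionSum S) = hContent S := by
  obtain ⟨μ, f, hf, rfl⟩ := exists_relabelling S
  rw [partitionSum_map hf, hContent_map hf, theta_partitionSum_contentOf, hContent_contentOf]

/-! ### Intertwining `divisorOp` with multiplication by power sums -/

lemma hContent_add_replicate {S : Multiset ℕ} {a : ℕ} (ha : a ∉ S) (n : ℕ) :
    hContent (S + Multiset.replicate n a) = completeH n * hContent S := by
  have h : (S + Multiset.replicate n a).toFinset ⊆ insert a S.toFinset := by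
    intro b hb
    rw [Multiset.mem_toFinset, Multiset.mem_add] at hb
    rw [Finset.mem_insert, Multiset.mem_toFinset]
    rcases hb with hb | hb
    · exact Or.inr hb
    · exact Or.inl (Multiset.eq_of_mem_replicate hb)
  have ha' : a ∉ S.toFinset := by rwa [Multiset.mem_toFinset]
  rw [hContent, Finset.prod_subset h, Finset.prod_insert ha']
  · congr 1
    · rw [Multiset.count_add, Multiset.count_replicate_self, Multiset.count_eq_zero_of_notMem ha,
        zero_add]
    · refine Finset.prod_congr rfl fun b hb => ?_
      rw [Multiset.count_add, Multiset.count_replicate, if_neg, add_zero]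
      rintro rfl
      exact ha' hb
  · intro b _ hb
    rw [Multiset.mem_toFinset] at hb
    rw [Multiset.count_eq_zero_of_notMem hb, completeH]

/-- On sums over multiset partitions, `theta` turns `divisorOp k` into multiplication by `p_k`. -/
lemma theta_divisorOp_partitionSum {k : ℕ} (hk : 0 < k) (S : Multiset ℕ) :
    theta (divisorOp k (partitionSum S)) = pSum k * hContent S := by
  induction k using Nat.strong_induction_on generalizing S with
  | _ k ih =>
    -- A fresh letter, to be added with multiplicity `k`: its factor in `hContent` is `h_k`, to
    -- which Newton's identity applies.
    obtain ⟨a, ha⟩ := Infinite.exists_notMem_finset S.toFinset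
    rw [Multiset.mem_toFinset] at ha
    have hcount : (S + Multiset.replicate k a).count a = k := by
      rw [Multiset.count_add, Multiset.count_replicate_self, Multiset.count_eq_zero_of_notMem ha,
        zero_add]
    have hsub : ∀ i ≤ k, S + Multiset.replicate k a - Multiset.replicate i a =
        S + Multiset.replicate (k - i) a := fun i hi => by
      obtain ⟨j, rfl⟩ := Nat.exists_eq_add_of_le hi
      rw [Nat.add_sub_cancel_left, Multiset.replicate_add, add_comm (Multiset.replicate i a),
        ← add_assoc, Multiset.add_sub_cancel_right]
    have h := congrArg theta (count_mul_partitionSum_eq_sum_divisorOp a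
      (S + Multiset.replicate k a))
    rw [hcount, ← nsmul_eq_mul, map_nsmul, theta_partitionSum, hContent_add_replicate ha, map_sum,
      nsmul_eq_mul, ← mul_assoc, newton, Finset.sum_mul] at h
    obtain ⟨k, rfl⟩ := Nat.exists_eq_succ_of_ne_zero hk.ne'
    rw [Nat.succ_eq_add_one, Finset.sum_Icc_succ_top (by omega),
      Finset.sum_Icc_succ_top (by omega)] at h
    have h2 : ∀ i ∈ Icc 1 k, theta (divisorOp i (partitionSum
        (S + Multiset.replicate (k + 1) a - Multiset.replicate i a))) =
        pSum i * completeH (k + 1 - i) * hContent S := by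
      intro i hi
      rw [mem_Icc] at hi
      rw [hsub i (by omega), ih i (by omega) (by omega), hContent_add_replicate ha, mul_assoc]
    rw [Finset.sum_congr rfl h2, hsub (k + 1) le_rfl, Nat.sub_self] at h
    -- The lower terms agree with those of Newton's identity by induction, so the top terms agree as
    -- well.
    have h3 := add_left_cancel h
    rw [Multiset.replicate_zero, add_zero, completeH, mul_one] at h3
    exact h3.symm

/-- `theta` turns `divisorOp k` into multiplication by `p_k`. -/
theorem theta_divisorOp {k : ℕ} (hk : 0 < k) (f : SymF) :
    theta (divisorOp k f) = pSum k * theta f := by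
  have hA : ∀ S, theta (divisorOp k (partitionSum S)) = pSum k * theta (partitionSum S) :=
    fun S => by rw [theta_divisorOp_partitionSum hk, theta_partitionSum]
  have hμ : ∀ (n : ℕ) (μ : YoungDiagram), μ.card = n →
      theta (divisorOp k (completeHProd μ)) = pSum k * theta (completeHProd μ) := by
    intro n
    induction n using Nat.strong_induction_on with
    | _ n ih =>
      intro μ hn
      have h := hA (contentOf μ)
      -- All terms other than `h_μ` belong to partitions of smaller size and are covered by the
      -- induction hypothesis.
      rw [partitionSum_contentOf] at h
      simp only [map_add, map_sum, mul_add, Finset.mul_sum] at h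
      rw [Finset.sum_congr rfl fun π hπ => ih _ (by
        rw [mem_filter, hn] at hπ; exact hπ.2) _ (card_multiplicityPartition π)] at h
      exact add_right_cancel h
  have : theta ∘ₗ divisorOp k = LinearMap.mulLeft ℚ (pSum k) ∘ₗ theta := by
    refine linearMap_ext_hProd fun m => ?_
    rw [← completeHProd_ofParts]
    exact hμ _ _ rfl
  exact LinearMap.congr_fun this f

/-! ### Determinants -/

lemma det_updateRow_eq_sum {n : Type*} [Fintype n] [DecidableEq n] {R : Type*} [CommRing R]
    (A : Matrix n n R) (i : n) (w : n → R) :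
    (A.updateRow i w).det = ∑ k, w k * A.adjugate k i := by
  rw [← Matrix.cramer_transpose_apply, Matrix.cramer_eq_adjugate_mulVec, Matrix.mulVec,
    ← Matrix.adjugate_transpose]
  simp [dotProduct, mul_comm]

/-- Multiplying the rows of `A` by `T`, one at a time, multiplies the determinant by `tr T`. -/
lemma sum_det_updateRow_mul {n : Type*} [Fintype n] [DecidableEq n] {R : Type*} [CommRing R]
    (A T : Matrix n n R) : ∑ i, (A.updateRow i ((A * T) i)).det = T.trace * A.det := by
  -- Expanding each modified row by cofactors turns the sum of determinants into this trace.
  have h : (A * T * A.adjugate).trace = T.trace * A.det := by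
    rw [mul_assoc, Matrix.trace_mul_comm, mul_assoc, Matrix.adjugate_mul, Matrix.mul_smul,
      mul_one, Matrix.trace_smul, smul_eq_mul, mul_comm]
  rw [← h]
  simp only [det_updateRow_eq_sum, Matrix.trace, Matrix.diag, Matrix.mul_apply (M := A * T)]

lemma derivation_det {n : Type*} [Fintype n] [DecidableEq n] (D : Derivation ℚ SymF SymF)
    (A : Matrix n n SymF) : D A.det = ∑ i, (A.updateRow i fun j => D (A i j)).det := by
  have hexp : ∀ B : Matrix n n SymF, B.det =
      ∑ σ : Equiv.Perm n, Equiv.Perm.sign σ • ∏ i, B i (σ i) := fun B => by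
    rw [← Matrix.det_transpose, Matrix.det_apply]
    rfl
  simp only [hexp]
  rw [map_sum, Finset.sum_comm]
  refine Finset.sum_congr rfl fun σ _ => ?_
  rw [Units.smul_def, map_zsmul, derivation_prod, Finset.smul_sum]
  refine Finset.sum_congr rfl fun i _ => ?_
  congr 1
  rw [← Finset.mul_prod_erase univ _ (Finset.mem_univ i), mul_comm]
  congr 1
  · simp
  · refine Finset.prod_congr rfl fun j hj => ?_
    rw [Matrix.updateRow_ne (Finset.ne_of_mem_erase hj)]

/-- In characteristic zero a polynomial whose partial derivatives all vanish is constant. -/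
lemma eq_zero_of_skewP {f : SymF} (h0 : constantCoeff f = 0)
    (h : ∀ e : ℕ, 0 < e → skewP e f = 0) : f = 0 := by
  ext m
  rw [coeff_zero]
  by_cases hm : m = 0
  · rw [hm]; exact h0
  obtain ⟨k, hk⟩ := Finsupp.ne_iff.1 hm
  have h1 := h k k.pos
  rw [skewP, Derivation.smul_apply, PNat.coe_toPNat', smul_eq_zero] at h1
  have h2 : pderiv k f = 0 := h1.resolve_left (by exact_mod_cast k.pos.ne')
  have h3 := coeff_pderiv (i := k) f (m - Finsupp.single k 1)
  have h4 : m - Finsupp.single k 1 + Finsupp.single k 1 = m := by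
    ext j
    simp only [Finsupp.add_apply, Finsupp.tsub_apply, Finsupp.single_apply]
    have := Nat.pos_of_ne_zero hk
    split_ifs with hj
    · subst hj; omega
    · omega
  rw [h2, h4, coeff_zero] at h3
  have h5 := h3.symm
  rw [mul_eq_zero] at h5
  exact h5.resolve_right (by positivity)

/-! ### Jacobi-Trudi determinants with a first row of ones -/

lemma skewP_completeHInt {d : ℕ} (hd : 0 < d) (n : ℤ) :
    skewP d (completeHInt n) = completeHInt (n - d) := by
  rw [completeHInt, completeHInt]
  by_cases hn : n < 0
  · rw [if_pos hn, if_pos (by omega), map_zero]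
  · rw [if_neg hn, skewP_completeH hd]
    by_cases hdn : d ≤ n.toNat
    · rw [if_pos hdn, if_neg (by omega)]
      congr 1; omega
    · rw [if_neg hdn, if_pos (by omega)]

lemma constantCoeff_completeHInt (n : ℤ) :
    constantCoeff (completeHInt n) = if n = 0 then 1 else 0 := by
  rw [completeHInt]
  by_cases hn : n < 0
  · rw [if_pos hn, if_neg (by omega), map_zero]
  · rw [if_neg hn]
    rcases h : n.toNat with _ | m
    · rw [if_pos (by omega), completeH, map_one]
    · rw [if_neg (by omega), completeH, map_mul, map_sum]
      simp [powerSum]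

section

variable {N : ℕ}

/-- The matrix with first row `1, 1, …` and further rows `h_{v_i}, h_{v_i + 1}, …`. -/
noncomputable def betaMatrix (v : Fin N → ℤ) : Matrix (Fin (N + 1)) (Fin (N + 1)) SymF :=
  Matrix.of (Fin.cons (fun _ => 1) fun i j => completeHInt (v i + (j : ℕ)))

/-- The determinant with first row `1, 1, …` and further rows `h_{v_i}, h_{v_i + 1}, …`. -/
noncomputable def betaDet (v : Fin N → ℤ) : SymF := (betaMatrix v).det

@[simp] lemma betaMatrix_zero (v : Fin N → ℤ) (j : Fin (N + 1)) : betaMatrix v 0 j = 1 := rfl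

@[simp] lemma betaMatrix_succ (v : Fin N → ℤ) (i : Fin N) (j : Fin (N + 1)) :
    betaMatrix v i.succ j = completeHInt (v i + (j : ℕ)) := rfl

/-- The columns run up to `N`, so all indices in this row are negative: `-N` is the least admissible
value. -/
lemma betaDet_eq_zero_of_lt {v : Fin N → ℤ} {i : Fin N} (h : v i < -N) : betaDet v = 0 := by
  refine Matrix.det_eq_zero_of_row_eq_zero i.succ fun j => ?_
  rw [betaMatrix_succ, completeHInt, if_pos (by omega)]

lemma betaDet_eq_zero_of_eq {v : Fin N → ℤ} {i j : Fin N} (hij : i ≠ j) (h : v i = v j) :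
    betaDet v = 0 := by
  refine Matrix.det_zero_of_row_eq (i := i.succ) (j := j.succ) (by simpa using hij) ?_
  funext c
  rw [betaMatrix_succ, betaMatrix_succ, h]

lemma betaDet_comp_perm (v : Fin N → ℤ) (σ : Equiv.Perm (Fin N)) :
    betaDet (v ∘ σ) = (Equiv.Perm.sign σ : ℤ) * betaDet v := by
  -- The permutation `decomposeFin.symm (0, σ)` extends `σ` by fixing the row of ones.
  have h := Matrix.det_permute (Equiv.Perm.decomposeFin.symm (0, σ)) (betaMatrix v)
  rw [Equiv.Perm.decomposeFin.symm_sign, if_pos rfl, one_mul] at h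
  rw [betaDet, betaDet, ← h]
  congr 1
  ext1 i j
  refine Fin.cases ?_ (fun i => ?_) i
  · simp
  · simp

lemma updateRow_betaMatrix (v : Fin N → ℤ) (i : Fin N) (x : ℤ) :
    (betaMatrix v).updateRow i.succ (fun j => completeHInt (x + (j : ℕ))) =
      betaMatrix (Function.update v i x) := by
  ext1 k j
  refine Fin.cases ?_ (fun k => ?_) k
  · rw [Matrix.updateRow_ne (Fin.succ_ne_zero i).symm]
    rfl
  · by_cases hk : k = i
    · subst hk
      rw [Matrix.updateRow_self, betaMatrix_succ, Function.update_self]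
    · rw [Matrix.updateRow_ne (by simpa using hk), betaMatrix_succ, betaMatrix_succ,
        Function.update_of_ne hk]

/-- Leibniz rule by rows: the row of ones is killed, and a row of `h`'s is shifted down by `d`. -/
lemma skewP_betaDet {d : ℕ} (hd : 0 < d) (v : Fin N → ℤ) :
    skewP d (betaDet v) = ∑ i, betaDet (Function.update v i (v i - d)) := by
  rw [betaDet, derivation_det, Fin.sum_univ_succ, Matrix.det_eq_zero_of_row_eq_zero 0, zero_add]
  · refine Finset.sum_congr rfl fun i _ => ?_
    rw [betaDet, ← updateRow_betaMatrix]
    congr 2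
    funext j
    rw [betaMatrix_succ, skewP_completeHInt hd]
    congr 1; ring
  · intro j
    simp

/-- The terms for `a` and `b` differ by a transposition and cancel; every other term still has two
equal rows. -/
lemma sum_betaDet_update_eq_zero {v : Fin N → ℤ} {a b : Fin N} (hab : a ≠ b) (h : v a = v b)
    (d : ℤ) : ∑ i, betaDet (Function.update v i (v i + d)) = 0 := by
  rw [Finset.sum_eq_add a b hab]
  · have : Function.update v a (v a + d) = Function.update v b (v b + d) ∘ Equiv.swap a b := by
      funext i
      rw [Function.comp_apply]
      by_cases hia : i = a
      · subst hia; rw [Equiv.swap_apply_left, Function.update_self, Function.update_self, h]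
      · by_cases hib : i = b
        · subst hib
          rw [Equiv.swap_apply_right, Function.update_of_ne hia, Function.update_of_ne hab, h]
        · rw [Equiv.swap_apply_of_ne_of_ne hia hib, Function.update_of_ne hia,
            Function.update_of_ne hib]
    rw [this, betaDet_comp_perm, Equiv.Perm.sign_swap hab]
    simp
  · intro c _ hc
    exact betaDet_eq_zero_of_eq hab (by
      rw [Function.update_of_ne hc.1.symm, Function.update_of_ne hc.2.symm, h])
  · simp
  · simp

lemma constantCoeff_betaDet (v : Fin N → ℤ) :
    constantCoeff (betaDet v) = ((betaMatrix v).map constantCoeff).det := by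
  rw [betaDet, RingHom.map_det]; rfl

/-- The comparison of constant terms in `(p_d - 1) D(v) = ∑ D(v + d ε_i)`. -/
lemma constantCoeff_sum_betaDet_update {d : ℕ} (hd : 0 < d) {v : Fin N → ℤ}
    (hv : ∀ i, -(N : ℤ) ≤ v i) (hinj : Function.Injective v)
    (hfull : ∀ x : ℤ, -N ≤ x → x < -N + d → ∃ i, v i = x) :
    ∑ i, constantCoeff (betaDet (Function.update v i (v i + d))) =
      - constantCoeff (betaDet v) := by
  set A := (betaMatrix v).map (constantCoeff : SymF →+* ℚ) with hA
  have hA0 : ∀ j, A 0 j = 1 := fun j => by simp [hA]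
  have hAs : ∀ i j, A (Fin.succ i) j = if v i + ((j : ℕ) : ℤ) = 0 then 1 else 0 := fun i j => by
    rw [hA, Matrix.map_apply, betaMatrix_succ, constantCoeff_completeHInt]
  -- Right multiplication by `T` shifts each row `d` columns to the left and fills up with zeros.
  -- Its trace is zero, hence so is the sum of the determinants with one row shifted.
  let T : Matrix (Fin (N + 1)) (Fin (N + 1)) ℚ := Matrix.of fun a b =>
    if (a : ℕ) = b + d then 1 else 0
  have hAT : ∀ i j, (A * T) i j = if h : (j : ℕ) + d < N + 1 then A i ⟨j + d, h⟩ else 0 := by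
    intro i j
    rw [Matrix.mul_apply]
    split_ifs with h
    · rw [Finset.sum_eq_single ⟨j + d, h⟩]
      · simp [T]
      · intro b _ hb
        have : (b : ℕ) ≠ j + d := fun h' => hb (Fin.ext h')
        simp [T, this]
      · simp
    · refine Finset.sum_eq_zero fun b _ => ?_
      have : (b : ℕ) ≠ j + d := by omega
      simp [T, this]
  have htr : T.trace = 0 := by
    refine Finset.sum_eq_zero fun a _ => ?_
    simp [T, hd.ne']
  have h := sum_det_updateRow_mul A T
  rw [htr, zero_mul, Fin.sum_univ_succ] at h
  -- The shifted row of ones has zeros in its last `d` columns. The rows with `v i < -N + d` are the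
  -- unit vectors of precisely these columns, so subtracting them from the row of ones gives the
  -- same vector.
  have h0 : (A.updateRow 0 ((A * T) 0)).det = A.det := by
    have hc := Matrix.det_updateRow_sum A 0
      (Fin.cons 1 fun i => if v i < -N + d then (-1 : ℚ) else 0)
    rw [Fin.cons_zero, one_smul] at hc
    rw [← hc]
    congr 2
    funext j
    rw [hAT, Finset.sum_apply, Fin.sum_univ_succ]
    simp only [Fin.cons_zero, Fin.cons_succ, Pi.smul_apply, hA0, hAs, smul_eq_mul]
    by_cases hj : (j : ℕ) + d < N + 1
    · rw [dif_pos hj, Finset.sum_eq_zero, add_zero, mul_one]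
      intro i _
      split_ifs
      · omega
      all_goals simp
    · rw [dif_neg hj]
      obtain ⟨i, hi⟩ := hfull (-(j : ℕ)) (by omega) (by omega)
      rw [Finset.sum_eq_single i]
      · rw [if_pos (by omega), if_pos (by omega)]
        norm_num
      · intro b _ hb
        have : v b ≠ v i := fun h' => hb (hinj h')
        rw [if_neg (by omega : ¬ v b + ((j : ℕ) : ℤ) = 0), mul_zero]
      · simp
  have hs : ∀ i : Fin N, (A.updateRow i.succ ((A * T) i.succ)).det =
      constantCoeff (betaDet (Function.update v i (v i + d))) := by
    intro i
    rw [constantCoeff_betaDet, ← updateRow_betaMatrix, Matrix.map_updateRow]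
    congr 2
    funext j
    have := hv i
    rw [hAT, Function.comp_apply, constantCoeff_completeHInt]
    by_cases hj : (j : ℕ) + d < N + 1
    · rw [dif_pos hj, hAs]
      congr 1
      push_cast
      rw [eq_iff_iff]
      constructor <;> intro <;> omega
    -- The entry cut off by the shift is zero anyway, because `v i ≥ -N`.
    · rw [dif_neg hj, if_neg (by omega)]
  rw [h0, Finset.sum_congr rfl fun i _ => hs i] at h
  rw [constantCoeff_betaDet]
  linarith

/-- These are the rows that lowering by `d` makes inadmissible; their number matches `p_d^⊥ p_d =
d`. -/
lemma card_filter_lt {d : ℕ} {v : Fin N → ℤ} (hv : ∀ i, -(N : ℤ) ≤ v i)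
    (hinj : Function.Injective v) (hfull : ∀ x : ℤ, -N ≤ x → x < -N + d → ∃ i, v i = x) :
    (univ.filter fun i => v i < -N + d).card = d := by
  rw [← Finset.card_image_of_injective _ hinj]
  have : (univ.filter fun i => v i < -N + d).image v = Ico (-(N : ℤ)) (-N + d) := by
    ext x
    simp only [mem_image, mem_filter, mem_univ, true_and, mem_Ico]
    constructor
    · rintro ⟨i, hi, rfl⟩
      exact ⟨hv i, hi⟩
    · rintro ⟨h1, h2⟩
      obtain ⟨i, rfl⟩ := hfull x h1 h2
      exact ⟨i, h2, rfl⟩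
  rw [this, Int.card_Ico]
  omega

/-- Multiplication by `p_d` (minus `1`) adds `d` to the entries of `v`, one at a time, as long as
`v` takes the `d` smallest admissible values. -/
lemma pSum_mul_betaDet {d : ℕ} (hd : 0 < d) {v : Fin N → ℤ} (hv : ∀ i, -(N : ℤ) ≤ v i)
    (hfull : ∀ x : ℤ, -N ≤ x → x < -N + d → ∃ i, v i = x) :
    (pSum d - 1) * betaDet v = ∑ i, betaDet (Function.update v i (v i + d)) := by
  -- Applying `p_e^⊥` lowers one entry, so the total excess over `-N` decreases.
  induction hn : (∑ i, (v i + N)).toNat using Nat.strong_induction_on generalizing v with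
  | _ n ih =>
    by_cases hinj : Function.Injective v
    swap
    · rw [Function.Injective] at hinj
      push Not at hinj
      obtain ⟨a, b, h, hab⟩ := hinj
      rw [betaDet_eq_zero_of_eq hab h, mul_zero, sum_betaDet_update_eq_zero hab h]
    rw [← sub_eq_zero]
    refine eq_zero_of_skewP ?_ fun e he => ?_
    · rw [map_sub, map_sum, constantCoeff_sum_betaDet_update hd hv hinj hfull, map_mul, map_sub]
      simp [pSum, powerSum]
    -- Lowering entry `j` by `e` commutes with the claimed formula, up to a copy of `D(v)` when `d =
    -- e` and `v j` is one of the `d` lowest values.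
    · have hj : ∀ j, (pSum d - 1) * betaDet (Function.update v j (v j - e)) +
          (if d = e ∧ v j < -N + d then betaDet v else 0) =
          ∑ i, betaDet (Function.update (Function.update v i (v i + d)) j
            (Function.update v i (v i + d) j - e)) := by
        intro j
        set w := Function.update v j (v j - e) with hw
        have hwj : w j = v j - e := Function.update_self ..
        have hwne : ∀ i, i ≠ j → w i = v i := fun i hi => Function.update_of_ne hi _ _
        have hcomm : ∀ i, Function.update (Function.update v i (v i + d)) j
            (Function.update v i (v i + d) j - e) = Function.update w i (w i + d) := by
          intro i
          by_cases hij : i = j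
          · subst hij
            rw [hw, Function.update_idem, Function.update_idem, Function.update_self,
              Function.update_self]
            congr 1; ring
          · rw [Function.update_of_ne (Ne.symm hij), hwne i hij, hw, Function.update_comm hij]
        rw [Finset.sum_congr rfl fun i _ => congrArg betaDet (hcomm i)]
        -- Entry `j` has become inadmissible, so only raising the same entry can give a nonzero
        -- term. If `d ≠ e`, the result is still below `-N` or collides with another row through
        -- `hfull`.
        by_cases hlow : v j < -N + e
        · rw [betaDet_eq_zero_of_lt (v := w) (i := j) (by omega), mul_zero, zero_add,
            Finset.sum_eq_single j]
          · rw [hw, Function.update_idem, Function.update_self]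
            by_cases hde : d = e
            · subst hde
              rw [if_pos ⟨rfl, hlow⟩, sub_add_cancel, Function.update_eq_self]
            · rw [if_neg (fun h => hde h.1)]
              by_cases hneg : v j - e + d < -N
              · exact (betaDet_eq_zero_of_lt (i := j) (by rwa [Function.update_self])).symm
              · obtain ⟨i, hi⟩ := hfull (v j - e + d) (by omega) (by omega)
                have hij : i ≠ j := by rintro rfl; omega
                exact (betaDet_eq_zero_of_eq hij (by
                  rw [Function.update_of_ne hij, Function.update_self, hi])).symm
          · intro i _ hij
            exact betaDet_eq_zero_of_lt (i := j) (by
              rw [Function.update_of_ne (Ne.symm hij), hwj]; omega)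
          · simp
        · rw [if_neg (by omega), add_zero]
          by_cases hwinj : Function.Injective w
          · refine ih _ ?_ ?_ ?_ rfl
            · have h1 : ∑ i, (w i + N) = ∑ i, (v i + N) - e := by
                rw [← Finset.add_sum_erase univ _ (mem_univ j),
                  ← Finset.add_sum_erase univ (fun i => v i + (N : ℤ)) (mem_univ j), hwj,
                  Finset.sum_congr rfl fun i hi => by rw [hwne i (Finset.ne_of_mem_erase hi)]]
                ring
              have h2 : 0 ≤ ∑ i, (w i + (N : ℤ)) := Finset.sum_nonneg fun i _ => by
                by_cases hij : i = j
                · subst hij; omega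
                · rw [hwne i hij]; linarith [hv i]
              omega
            · intro i
              by_cases hij : i = j
              · subst hij; omega
              · rw [hwne i hij]; exact hv i
            · intro x h1 h2
              obtain ⟨i, hi⟩ := hfull x h1 h2
              by_cases hij : i = j
              · subst hij
                -- If a low value was held by the lowered row, the new value is low too and already
                -- occupied, against injectivity of `w`.
                obtain ⟨i', hi'⟩ := hfull (v i - e) (by omega) (by omega)
                have hne : i' ≠ i := by rintro rfl; omega
                exact absurd (hwinj (by rw [hwne i' hne, hwj, hi'])) hne
              · exact ⟨i, by rw [hwne i hij, hi]⟩
          · rw [Function.Injective] at hwinj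
            push Not at hwinj
            obtain ⟨a, b, h, hab⟩ := hwinj
            rw [betaDet_eq_zero_of_eq hab h, mul_zero, sum_betaDet_update_eq_zero hab h]
      rw [map_sub, map_sum, Finset.sum_congr rfl fun i _ => skewP_betaDet he _, Finset.sum_comm,
        ← Finset.sum_congr rfl fun j _ => hj j, Finset.sum_add_distrib, ← Finset.mul_sum,
        ← skewP_betaDet he, Derivation.leibniz, map_sub, Derivation.map_one_eq_zero,
        skewP_pSum he hd, smul_eq_mul, smul_eq_mul]
      by_cases hde : d = e
      · subst hde
        simp only [true_and, if_true]
        rw [← Finset.sum_filter, Finset.sum_const, card_filter_lt hv hinj hfull, nsmul_eq_mul]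
        ring
      · simp [hde]

end

/-! ### Independence of the determinant from its size -/

/-- The determinant of size `N + 1` attached to a partition. -/
noncomputable def stableSchurAux (N : ℕ) (lam : YoungDiagram) : SymF :=
  betaDet fun i : Fin N => (lam.rowLen i : ℤ) - (i + 1)

/-- The stable part of the Schur functions `s_{(n - |λ|, λ)}`. -/
noncomputable def stableSchur (lam : YoungDiagram) : SymF := stableSchurAux (lam.colLen 0) lam

lemma rowLen_eq_zero {lam : YoungDiagram} {i : ℕ} (h : lam.colLen 0 ≤ i) : lam.rowLen i = 0 := by
  by_contra h'
  have := rowLen_pos_iff.1 (Nat.pos_of_ne_zero h')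
  omega

/-- A zero row of the partition makes the last row of the matrix `(0, …, 0, 1)`; expand along it. -/
lemma stableSchurAux_succ {N : ℕ} {lam : YoungDiagram} (h : lam.colLen 0 ≤ N) :
    stableSchurAux (N + 1) lam = stableSchurAux N lam := by
  rw [stableSchurAux, betaDet, Matrix.det_succ_row _ (Fin.last (N + 1)),
    Finset.sum_eq_single (Fin.last (N + 1))]
  · rw [← Fin.succ_last, betaMatrix_succ, Fin.val_last, rowLen_eq_zero h, completeHInt,
      if_neg (by simp)]
    have : (((0 : ℕ) : ℤ) - (((N : ℕ) : ℤ) + 1) + ((Fin.last N).succ : ℕ)).toNat = 0 := by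
      simp
    rw [this, completeH, mul_one, Even.neg_one_pow ⟨_, rfl⟩, one_mul, Fin.succ_last,
      stableSchurAux, betaDet]
    congr 1
    ext1 i j
    rw [Matrix.submatrix_apply, Fin.succAbove_last]
    refine Fin.cases ?_ (fun i => ?_) i
    · rfl
    · rw [Fin.castSucc_succ, betaMatrix_succ, betaMatrix_succ]
      simp
  · intro j _ hj
    have hj' : (j : ℕ) < N + 1 := Fin.val_lt_last hj
    rw [← Fin.succ_last, betaMatrix_succ, Fin.val_last, rowLen_eq_zero h, completeHInt,
      if_pos (by push_cast; omega)]
    simp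
  · simp

lemma stableSchurAux_eq {N : ℕ} {lam : YoungDiagram} (h : lam.colLen 0 ≤ N) :
    stableSchurAux N lam = stableSchur lam := by
  induction N, h using Nat.le_induction with
  | base => rfl
  | succ N h ih => rw [stableSchurAux_succ h, ih]

/-! ### Border strips in terms of row lengths -/

/-- The diagram with rows `f` arises from the one with rows `g` by adding a border strip of size
`d` that occupies the rows `p, …, q`. -/
structure IsRim (d : ℕ) (f g : ℕ → ℕ) (p q : ℕ) : Prop where
  le : p ≤ q
  above : ∀ i < p, g i = f i
  below : ∀ i, q < i → g i = f i
  mid : ∀ i, p ≤ i → i < q → g i + 1 = f (i + 1)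
  last : g q < f q
  size : g q + d + p = f p + q

namespace IsRim

variable {d p q : ℕ} {f g : ℕ → ℕ}

lemma lt_iff (h : IsRim d f g p q) (hf : Antitone f) (i : ℕ) : g i < f i ↔ p ≤ i ∧ i ≤ q := by
  constructor
  · intro hi
    by_contra hc
    rw [not_and_or, not_le, not_le] at hc
    rcases hc with hc | hc
    · have := h.above i hc; omega
    · have := h.below i hc; omega
  · rintro ⟨h1, h2⟩
    rcases h2.lt_or_eq with h2 | rfl
    · have h3 := h.mid i h1 h2
      have h4 : f (i + 1) ≤ f i := hf (Nat.le_succ i)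
      omega
    · exact h.last

lemma le_rows (h : IsRim d f g p q) (hf : Antitone f) (i : ℕ) : g i ≤ f i := by
  by_cases hi : g i < f i
  · exact hi.le
  · rw [h.lt_iff hf, not_and_or, not_le, not_le] at hi
    rcases hi with hi | hi
    · exact (h.above i hi).le
    · exact (h.below i hi).le

lemma unique (h : IsRim d f g p q) (hf : Antitone f) {p' q' : ℕ} (h' : IsRim d f g p' q') :
    p = p' ∧ q = q' := by
  have h1 := (h'.lt_iff hf p).1 ((h.lt_iff hf p).2 ⟨le_rfl, h.le⟩)
  have h2 := (h.lt_iff hf p').1 ((h'.lt_iff hf p').2 ⟨le_rfl, h'.le⟩)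
  have h3 := (h'.lt_iff hf q).1 ((h.lt_iff hf q).2 ⟨h.le, le_rfl⟩)
  have h4 := (h.lt_iff hf q').1 ((h'.lt_iff hf q').2 ⟨h'.le, le_rfl⟩)
  omega

end IsRim

/-- The finite set of cells between the rows `g` and `f`. -/
def IsRowSkew (f g : ℕ → ℕ) (S : Finset (ℕ × ℕ)) : Prop :=
  ∀ i j, (i, j) ∈ S ↔ g i ≤ j ∧ j < f i

section

variable {d p q : ℕ} {f g : ℕ → ℕ} {S : Finset (ℕ × ℕ)}

lemma IsRowSkew.exists_mem (hS : IsRowSkew f g S) (i : ℕ) :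
    i ∈ S.image Prod.fst ↔ g i < f i := by
  rw [mem_image]
  constructor
  · rintro ⟨⟨i, j⟩, h, rfl⟩
    have := (hS i j).1 h
    simp only; omega
  · intro h
    exact ⟨(i, g i), (hS _ _).2 ⟨le_rfl, h⟩, rfl⟩

/-- The sum telescopes because consecutive rows of the strip overlap in exactly one column. -/
lemma sum_rows_eq (hpq : p ≤ q) (hmid : ∀ i, p ≤ i → i < q → g i + 1 = f (i + 1)) :
    ∑ i ∈ Icc p q, ((f i : ℤ) - g i) = f p - g q + (q - p) := by
  induction q, hpq using Nat.le_induction with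
  | base => simp
  | succ q hpq ih =>
    rw [Finset.sum_Icc_succ_top (by omega), ih fun i h1 h2 => hmid i h1 (by omega)]
    have := hmid q hpq (Nat.lt_succ_self q)
    push_cast
    omega

lemma IsRowSkew.card_eq (hS : IsRowSkew f g S) (hpq : p ≤ q)
    (hrow : ∀ i, g i < f i ↔ p ≤ i ∧ i ≤ q)
    (hmid : ∀ i, p ≤ i → i < q → g i + 1 = f (i + 1)) : S.card + g q + p = f p + q := by
  have h1 : S.card = ∑ i ∈ Icc p q, (f i - g i) := by
    rw [Finset.card_eq_sum_card_fiberwise (f := Prod.fst) (t := Icc p q)]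
    · refine Finset.sum_congr rfl fun i _ => ?_
      rw [← Nat.card_Ico, ← Finset.card_image_of_injective (Ico (g i) (f i))
        (f := fun j => (i, j)) fun a b h => (Prod.mk.inj h).2]
      congr 1
      ext ⟨a, b⟩
      simp only [mem_filter, mem_image, mem_Ico, Prod.mk.injEq]
      constructor
      · rintro ⟨h, rfl⟩
        exact ⟨b, (hS _ _).1 h, rfl, rfl⟩
      · rintro ⟨j, h, rfl, rfl⟩
        exact ⟨(hS _ _).2 h, rfl⟩
    · rintro ⟨i, j⟩ h
      have h' := (hS i j).1 h
      have := (hrow i).1 (by omega)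
      simpa using this
  have h2 : (S.card : ℤ) = ∑ i ∈ Icc p q, ((f i : ℤ) - g i) := by
    rw [h1, Nat.cast_sum]
    refine Finset.sum_congr rfl fun i hi => ?_
    rw [mem_Icc] at hi
    have := (hrow i).2 hi
    omega
  rw [sum_rows_eq hpq hmid] at h2
  omega

lemma IsRim.card_eq (h : IsRim d f g p q) (hf : Antitone f) (hS : IsRowSkew f g S) :
    S.card = d := by
  have := hS.card_eq h.le (h.lt_iff hf) h.mid
  have := h.size
  omega

lemma IsRim.card_image_fst (h : IsRim d f g p q) (hf : Antitone f) (hS : IsRowSkew f g S) :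
    (S.image Prod.fst).card - 1 = q - p := by
  have : S.image Prod.fst = Icc p q := by
    ext i
    rw [hS.exists_mem, h.lt_iff hf, mem_Icc]
  rw [this, Nat.card_Icc]
  omega

/-- Each row is an interval that meets the row above in one column: this links every cell to the end
of the top row and leaves no room for a `2 × 2` square. -/
lemma IsRim.isBorderStrip (h : IsRim d f g p q) (hf : Antitone f) (hS : IsRowSkew f g S) :
    IsBorderStrip d S := by
  refine ⟨h.card_eq hf hS, ?_, ?_⟩
  · set R : ℕ × ℕ → ℕ × ℕ → Prop := fun x y => x ∈ S ∧ y ∈ S ∧ Adjacent x y with hR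
    have hsymm : Std.Symm R := by
      refine ⟨?_⟩
      rintro ⟨a, b⟩ ⟨a', b'⟩ ⟨h1, h2, h3⟩
      refine ⟨h2, h1, ?_⟩
      rw [Adjacent] at h3 ⊢
      simp only at h3 ⊢
      omega
    have hright : ∀ i j k, (i, j) ∈ S → (i, j + k) ∈ S →
        Relation.ReflTransGen R (i, j) (i, j + k) := by
      intro i j k h1 h2
      induction k with
      | zero => exact Relation.ReflTransGen.refl
      | succ k ih =>
        have h3 : (i, j + k) ∈ S := by
          rw [hS] at h1 h2 ⊢; omega
        exact (ih h3).tail ⟨h3, h2, Or.inl ⟨rfl, Or.inl rfl⟩⟩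
    have hend : ∀ i j, (i, j) ∈ S → Relation.ReflTransGen R (i, j) (i, f i - 1) := by
      intro i j h1
      have h2 := (hS i j).1 h1
      have h3 := hright i j (f i - 1 - j) h1 ((hS _ _).2 (by omega))
      rwa [show j + (f i - 1 - j) = f i - 1 by omega] at h3
    have hconn : ∀ i, p ≤ i → ∀ j, (i, j) ∈ S →
        Relation.ReflTransGen R (i, j) (p, f p - 1) := by
      intro i hi
      induction i, hi using Nat.le_induction with
      | base => exact hend p
      | succ i hi ih =>
        intro j hj
        have h1 := (hS _ _).1 hj
        have h2 := (h.lt_iff hf (i + 1)).1 (by omega)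
        have h3 := h.mid i hi (by omega)
        have h4 := (h.lt_iff hf i).2 (by omega)
        have h5 : f (i + 1) - 1 = g i := by omega
        have h6 := hend _ _ hj
        rw [h5] at h6
        have h7 : (i, g i) ∈ S := (hS _ _).2 ⟨le_rfl, h4⟩
        have h8 : (i + 1, g i) ∈ S := (hS _ _).2 (by omega)
        exact (h6.tail ⟨h8, h7, Or.inr ⟨rfl, Or.inr rfl⟩⟩).trans (ih _ h7)
    have hall : ∀ a ∈ S, Relation.ReflTransGen R a (p, f p - 1) := by
      rintro ⟨i, j⟩ ha
      have h1 := (hS _ _).1 ha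
      exact hconn i ((h.lt_iff hf i).1 (by omega)).1 j ha
    exact fun a ha b hb => (hall a ha).trans (Relation.ReflTransGen.stdSymm.symm _ _ (hall b hb))
  · rintro ⟨i, j, h1, h2, h3, h4⟩
    rw [hS] at h1 h2 h3 h4
    have h5 := (h.lt_iff hf i).1 (by omega)
    have h6 := (h.lt_iff hf (i + 1)).1 (by omega)
    have := h.mid i h5.1 (by omega)
    omega

/-- Connectedness forces consecutive rows to overlap in at least one column, and the absence of `2 ×
2` squares in at most one. -/
lemma exists_isRim (hd : 0 < d) (hf : Antitone f) (hg : Antitone g) (hgf : ∀ i, g i ≤ f i)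
    (hS : IsRowSkew f g S) (h : IsBorderStrip d S) : ∃ p q, IsRim d f g p q := by
  obtain ⟨hcard, hconn, hsq⟩ := h
  have hne : (S.image Prod.fst).Nonempty := by
    rw [Finset.image_nonempty, ← Finset.card_pos]; omega
  set p := (S.image Prod.fst).min' hne with hp
  set q := (S.image Prod.fst).max' hne with hq
  have hpm := Finset.min'_mem _ hne
  have hqm := Finset.max'_mem _ hne
  rw [← hp, hS.exists_mem] at hpm
  rw [← hq, hS.exists_mem] at hqm
  have hpq : p ≤ q := Finset.min'_le_max' _ hne
  have hout : ∀ i, g i < f i → p ≤ i ∧ i ≤ q := fun i hi =>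
    ⟨Finset.min'_le _ _ ((hS.exists_mem i).2 hi), Finset.le_max' _ _ ((hS.exists_mem i).2 hi)⟩
  -- A path from above to below passes from row `i` to row `i + 1` along a vertical edge, whose
  -- column lies in both rows.
  have hcross : ∀ i a b, Relation.ReflTransGen (fun x y => x ∈ S ∧ y ∈ S ∧ Adjacent x y) a b →
      a.1 ≤ i → i < b.1 → g i + 1 ≤ f (i + 1) := by
    intro i a b hab ha
    induction hab with
    | refl => intro hb; omega
    | @tail b c _ hbc ih =>
      intro hc
      by_cases hb : i < b.1
      · exact ih hb
      · obtain ⟨h1, h2, h3⟩ := hbc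
        obtain ⟨b1, b2⟩ := b
        obtain ⟨c1, c2⟩ := c
        rw [Adjacent] at h3
        rw [hS] at h1 h2
        simp only at hb hc h3
        obtain rfl : b1 = i := by omega
        obtain rfl : c1 = b1 + 1 := by omega
        omega
  have hmid : ∀ i, p ≤ i → i < q → g i + 1 = f (i + 1) := by
    intro i h1 h2
    refine le_antisymm ?_ ?_
    · exact hcross i (p, g p) (q, g q) (hconn _ ((hS _ _).2 ⟨le_rfl, hpm⟩) _
        ((hS _ _).2 ⟨le_rfl, hqm⟩)) h1 h2
    · by_contra hc
      have h3 : f (i + 1) ≤ f i := hf (Nat.le_succ i)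
      have h4 : g (i + 1) ≤ g i := hg (Nat.le_succ i)
      refine hsq ⟨i, g i, ?_, ?_, ?_, ?_⟩ <;> rw [hS] <;> omega
  have hrow : ∀ i, g i < f i ↔ p ≤ i ∧ i ≤ q := by
    refine fun i => ⟨hout i, fun hi => ?_⟩
    rcases hi.2.lt_or_eq with h2 | rfl
    · have h3 := hmid i hi.1 h2
      have h4 : f (i + 1) ≤ f i := hf (Nat.le_succ i)
      omega
    · exact hqm
  have := hS.card_eq hpq hrow hmid
  refine ⟨p, q, hpq, ?_, ?_, hmid, hqm, by omega⟩
  · intro i hi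
    by_contra hc
    have := hout i (lt_of_le_of_ne (hgf i) hc)
    omega
  · intro i hi
    by_contra hc
    have := hout i (lt_of_le_of_ne (hgf i) hc)
    omega

end

/-! ### Partitions with a long first row added -/

lemma rowLen_antitone (lam : YoungDiagram) : Antitone lam.rowLen := fun i j h =>
  lam.rowLen_anti i j h

lemma ext_rowLen {lam α : YoungDiagram} (h : ∀ i, lam.rowLen i = α.rowLen i) : lam = α := by
  ext ⟨i, j⟩
  rw [YoungDiagram.mem_cells, YoungDiagram.mem_cells, YoungDiagram.mem_iff_lt_rowLen,
    YoungDiagram.mem_iff_lt_rowLen, h]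

lemma le_iff_rowLen {lam α : YoungDiagram} : α ≤ lam ↔ ∀ i, α.rowLen i ≤ lam.rowLen i := by
  constructor
  · intro h i
    by_contra hc
    have h1 : (i, lam.rowLen i) ∈ α := YoungDiagram.mem_iff_lt_rowLen.2 (by omega)
    have h2 := YoungDiagram.mem_iff_lt_rowLen.1 (h h1)
    omega
  · rintro h ⟨i, j⟩ hij
    exact YoungDiagram.mem_iff_lt_rowLen.2 ((YoungDiagram.mem_iff_lt_rowLen.1 hij).trans_le (h i))

lemma rowLen_le_card (lam : YoungDiagram) (i : ℕ) : lam.rowLen i ≤ lam.card := by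
  rw [YoungDiagram.rowLen_eq_card]
  exact Finset.card_le_card (Finset.filter_subset _ _)

/-- The row lengths of `(r - |λ|, λ)`. -/
def paddedRow (r : ℕ) (lam : YoungDiagram) : ℕ → ℕ
  | 0 => r - lam.card
  | i + 1 => lam.rowLen i

lemma mem_paddedCells {r : ℕ} {lam : YoungDiagram} {i j : ℕ} :
    (i, j) ∈ paddedCells r lam ↔ j < paddedRow r lam i := by
  rw [paddedCells, YoungDiagram.mem_cellsOfRowLens]
  rcases i with _ | i
  · simp [paddedRow]
  · rw [paddedRow, ← YoungDiagram.mem_iff_lt_rowLen]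
    conv_rhs => rw [← YoungDiagram.ofRowLens_to_rowLens_eq_self (μ := lam),
      YoungDiagram.mem_ofRowLens]
    simp

lemma paddedRow_antitone {r : ℕ} {lam : YoungDiagram} (h : 2 * lam.card ≤ r) :
    Antitone (paddedRow r lam) := by
  refine antitone_nat_of_succ_le fun i => ?_
  rcases i with _ | i
  · have := rowLen_le_card lam 0
    simp only [paddedRow]
    omega
  · exact rowLen_antitone lam (Nat.le_succ i)

lemma isRowSkew_skewCells (r d : ℕ) (lam α : YoungDiagram) :
    IsRowSkew (paddedRow r lam) (paddedRow (r - d) α) (skewCells r d lam α) := by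
  intro i j
  rw [skewCells, mem_sdiff, mem_paddedCells, mem_paddedCells, not_lt, and_comm]

lemma isRowSkew_cells (lam α : YoungDiagram) :
    IsRowSkew lam.rowLen α.rowLen (lam.cells \ α.cells) := by
  intro i j
  rw [mem_sdiff, YoungDiagram.mem_cells, YoungDiagram.mem_cells, YoungDiagram.mem_iff_lt_rowLen,
    YoungDiagram.mem_iff_lt_rowLen, not_lt, and_comm]

lemma IsRim.card_add {d p q : ℕ} {lam α : YoungDiagram}
    (h : IsRim d lam.rowLen α.rowLen p q) : α.card + d = lam.card := by
  have h1 := h.card_eq (rowLen_antitone lam) (isRowSkew_cells lam α)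
  have h2 : α ≤ lam := le_iff_rowLen.2 (h.le_rows (rowLen_antitone lam))
  rw [Finset.card_sdiff_of_subset (YoungDiagram.cells_subset_iff.2 h2)] at h1
  have h3 : α.card ≤ lam.card := Finset.card_le_card (YoungDiagram.cells_subset_iff.2 h2)
  have h4 : lam.card - α.card = d := h1
  omega

section

variable {r d : ℕ} {lam α : YoungDiagram}

lemma isDoubleSlashStrip_iff_padded (hd : 0 < d) (h1 : 2 * lam.card ≤ r)
    (h2 : d + 2 * α.card ≤ r) : IsDoubleSlashStrip r d lam α ↔
      ∃ p q, IsRim d (paddedRow r lam) (paddedRow (r - d) α) p q := by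
  have hf := paddedRow_antitone h1
  have hg : Antitone (paddedRow (r - d) α) := paddedRow_antitone (by omega)
  constructor
  · rintro ⟨hsub, hb⟩
    refine exists_isRim hd hf hg (fun i => ?_) (isRowSkew_skewCells r d lam α) hb
    by_contra hc
    have h3 : (i, paddedRow r lam i) ∈ paddedCells (r - d) α := mem_paddedCells.2 (by omega)
    have := mem_paddedCells.1 (hsub h3)
    omega
  · rintro ⟨p, q, h⟩
    refine ⟨?_, h.isBorderStrip hf (isRowSkew_skewCells r d lam α)⟩
    rintro ⟨i, j⟩ hij
    exact mem_paddedCells.2 ((mem_paddedCells.1 hij).trans_le (h.le_rows hf i))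

/-- The strip is horizontal and consists of the last `d` cells of the long first row. -/
lemma isRim_padded_self (hd : 0 < d) (h : d + lam.card ≤ r) :
    IsRim d (paddedRow r lam) (paddedRow (r - d) lam) 0 0 where
  le := le_rfl
  above := by simp
  below i hi := by
    obtain ⟨i, rfl⟩ := Nat.exists_eq_succ_of_ne_zero hi.ne'
    rfl
  mid := by simp
  last := by simp only [paddedRow]; omega
  size := by simp only [paddedRow]; omega

lemma IsRim.padded {p q : ℕ} (h : IsRim d lam.rowLen α.rowLen p q) :
    IsRim d (paddedRow r lam) (paddedRow (r - d) α) (p + 1) (q + 1) where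
  le := Nat.succ_le_succ h.le
  above i hi := by
    rcases i with _ | i
    · have := h.card_add
      simp only [paddedRow]; omega
    · exact h.above i (by omega)
  below i hi := by
    rcases i with _ | i
    · omega
    · exact h.below i (by omega)
  mid i h1 h2 := by
    rcases i with _ | i
    · omega
    · exact h.mid i (by omega) (by omega)
  last := h.last
  size := by
    have := h.size
    simp only [paddedRow]; omega

/-- For large `r` the inner first row is at least as long as `λ_1`, so a strip that meets the first
row cannot continue below it; then `α = λ`. All other strips lie below the first row. -/
lemma isDoubleSlashStrip_iff (hd : 0 < d) (h1 : 2 * lam.card ≤ r) (h2 : d + 2 * α.card ≤ r)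
    (h3 : d + α.card + lam.card ≤ r) : IsDoubleSlashStrip r d lam α ↔
      α = lam ∨ ∃ p q, IsRim d lam.rowLen α.rowLen p q := by
  rw [isDoubleSlashStrip_iff_padded hd h1 h2]
  constructor
  · rintro ⟨p, q, h⟩
    rcases p with _ | p
    · have hq : q = 0 := by
        by_contra hq
        have h4 := h.mid 0 le_rfl (Nat.pos_of_ne_zero hq)
        have := rowLen_le_card lam 0
        simp only [paddedRow] at h4
        omega
      subst hq
      exact Or.inl (ext_rowLen fun i => h.below (i + 1) (Nat.succ_pos i))
    · obtain ⟨q, rfl⟩ := Nat.exists_eq_succ_of_ne_zero (show q ≠ 0 by have := h.le; omega)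
      refine Or.inr ⟨p, q, Nat.succ_le_succ_iff.1 h.le, ?_, ?_, ?_, h.last, ?_⟩
      · exact fun i hi => h.above (i + 1) (by omega)
      · exact fun i hi => h.below (i + 1) (by omega)
      · exact fun i h4 h5 => h.mid (i + 1) (by omega) (by omega)
      · have := h.size
        simp only [paddedRow] at this
        omega
  · rintro (rfl | ⟨p, q, h⟩)
    · exact ⟨0, 0, isRim_padded_self hd (by omega)⟩
    · exact ⟨_, _, h.padded⟩

lemma height_self (hd : 0 < d) (h1 : 2 * lam.card ≤ r) (h2 : d + lam.card ≤ r) :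
    height r d lam lam = 0 :=
  (isRim_padded_self hd h2).card_image_fst (paddedRow_antitone h1)
    (isRowSkew_skewCells r d lam lam)

lemma IsRim.height_eq {p q : ℕ} (h : IsRim d lam.rowLen α.rowLen p q)
    (h1 : 2 * lam.card ≤ r) : height r d lam α = q - p := by
  have := h.padded.card_image_fst (paddedRow_antitone h1) (isRowSkew_skewCells r d lam α)
  rw [height, this]
  omega

end

/-! ### Removing and adding border strips -/

lemma exists_rowLen_eq {f : ℕ → ℕ} (hf : Antitone f) {N : ℕ} (hN : ∀ i, N ≤ i → f i = 0) :
    ∃ μ : YoungDiagram, μ.rowLen = f := by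
  refine ⟨⟨(range N ×ˢ range (f 0)).filter fun c => c.2 < f c.1, ?_⟩, ?_⟩
  · rintro ⟨a, b⟩ ⟨a', b'⟩ hle h
    have ha : a' ≤ a := hle.1
    have hb : b' ≤ b := hle.2
    have := hf ha
    simp only [coe_filter, mem_product, mem_range, Set.mem_ofPred_eq] at h ⊢
    omega
  · funext i
    refine eq_of_forall_lt_iff fun j => ?_
    rw [← YoungDiagram.mem_iff_lt_rowLen, ← YoungDiagram.mem_cells]
    simp only [mem_filter, mem_product, mem_range]
    refine ⟨fun h => h.2, fun h => ⟨⟨?_, ?_⟩, h⟩⟩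
    · by_contra hc
      have := hN i (by omega)
      omega
    · exact h.trans_le (hf (Nat.zero_le i))

/-- The decreasing sequence `λ_i - (i + 1)`. -/
def beta (lam : YoungDiagram) (i : ℕ) : ℤ := lam.rowLen i - (i + 1)

lemma beta_succ_lt (lam : YoungDiagram) (i : ℕ) : beta lam (i + 1) < beta lam i := by
  have := rowLen_antitone lam (Nat.le_succ i)
  simp only [beta, Nat.succ_eq_add_one] at this ⊢
  push_cast
  omega

lemma beta_strictAnti (lam : YoungDiagram) : StrictAnti (beta lam) :=
  strictAnti_nat_of_succ_lt (beta_succ_lt lam)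

lemma beta_of_le {lam : YoungDiagram} {i : ℕ} (h : lam.colLen 0 ≤ i) :
    beta lam i = -(i + 1) := by
  rw [beta, rowLen_eq_zero h]; simp

lemma exists_isRim_remove {d N p : ℕ} {lam : YoungDiagram} (hd : 0 < d)
    (hN : lam.colLen 0 ≤ N) (hp : p < N) (hlow : -(N : ℤ) ≤ beta lam p - d)
    (hne : ∀ i < N, i ≠ p → beta lam i ≠ beta lam p - d) :
    ∃ (α : YoungDiagram) (q : ℕ), IsRim d lam.rowLen α.rowLen p q := by
  set y := beta lam p - d with hy
  -- Beyond row `N` the entries are `-(i + 1) < -N ≤ y`, so `y` differs from all entries.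
  have hne' : ∀ i, beta lam i ≠ y := by
    intro i
    by_cases hi : i < N
    · by_cases hip : i = p
      · rw [hip]; omega
      · exact hne i hi hip
    · rw [beta_of_le (by omega)]; omega
  -- After sorting, `y` takes position `q`; the entries of rows `p + 1, …, q` move up one place,
  -- which costs each of those rows one cell.
  set q := Nat.findGreatest (fun i => y < beta lam i) N with hq
  have hpq : p ≤ q := Nat.le_findGreatest hp.le (by omega)
  have hqy : y < beta lam q :=
    Nat.findGreatest_spec (P := fun i => y < beta lam i) hp.le (by omega)
  have hq1 : beta lam (q + 1) < y := by
    refine lt_of_le_of_ne ?_ (hne' _)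
    by_contra hc
    by_cases hqN : q + 1 ≤ N
    · exact Nat.findGreatest_is_greatest (Nat.lt_succ_self q) hqN (not_le.1 hc)
    · rw [beta_of_le (by omega)] at hc
      push_cast at hc
      omega
  have hle : ∀ i ≤ q, y < beta lam i := fun i hi =>
    hqy.trans_le ((beta_strictAnti lam).antitone hi)
  have hanti : ∀ i, lam.rowLen (i + 1) ≤ lam.rowLen i := fun i =>
    rowLen_antitone lam (Nat.le_succ i)
  have hrow : ∀ i ≤ q, y + i + 1 < lam.rowLen i := fun i hi => by
    have := hle i hi; rw [beta] at this; omega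
  have hrow1 : (lam.rowLen (q + 1) : ℤ) ≤ y + q + 1 := by
    rw [beta] at hq1; push_cast at hq1; omega
  have hrowp : y = lam.rowLen p - (p + 1) - d := by rw [hy, beta]
  set f : ℕ → ℕ := fun i => if i < p ∨ q < i then lam.rowLen i else
    if i < q then lam.rowLen (i + 1) - 1 else (y + q + 1).toNat with hf
  have hf1 : ∀ i, (i < p ∨ q < i) → f i = lam.rowLen i := fun i hi => if_pos hi
  have hf2 : ∀ i, p ≤ i → i < q → f i = lam.rowLen (i + 1) - 1 := fun i h1 h2 => by
    simp only [hf]; rw [if_neg (by omega), if_pos h2]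
  have hf3 : f q = (y + q + 1).toNat := by
    simp only [hf]; rw [if_neg (by omega), if_neg (by omega)]
  have hpos : ∀ i, p ≤ i → i < q → 0 < lam.rowLen (i + 1) := fun i _ h2 => by
    have h3 := hrow q le_rfl
    have h4 := rowLen_antitone lam (show i + 1 ≤ q from h2)
    omega
  have hfanti : Antitone f := by
    refine antitone_nat_of_succ_le fun i => ?_
    have h1 := hanti i
    have h2 := hanti (i + 1)
    have hq2 := hrow q le_rfl
    rcases lt_trichotomy (i + 1) p with h | h | h
    · rw [hf1 i (by omega), hf1 (i + 1) (by omega)]; exact h1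
    · rw [hf1 i (by omega)]
      rcases hpq.lt_or_eq with h3 | h3
      · rw [hf2 (i + 1) (by omega) (by omega)]; omega
      · rw [h, h3, hf3]; rw [h, h3] at h1; omega
    · rcases lt_trichotomy i q with h3 | h3 | h3
      · rw [hf2 i (by omega) h3]
        rcases (show i + 1 ≤ q from h3).lt_or_eq with h4 | h4
        · rw [hf2 (i + 1) (by omega) h4]; omega
        · rw [h4, hf3]; omega
      · rw [hf1 (i + 1) (by omega), h3, hf3]; omega
      · rw [hf1 i (by omega), hf1 (i + 1) (by omega)]; exact h1
  obtain ⟨α, hα⟩ := exists_rowLen_eq hfanti (N := max N (q + 1)) fun i hi => by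
    rw [hf1 i (by omega), rowLen_eq_zero (by omega)]
  refine ⟨α, q, hpq, ?_, ?_, ?_, ?_, ?_⟩
  · intro i hi; rw [hα, hf1 i (Or.inl hi)]
  · intro i hi; rw [hα, hf1 i (Or.inr hi)]
  · intro i h1 h2
    have := hpos i h1 h2
    rw [hα, hf2 i h1 h2]; omega
  · have := hrow q le_rfl
    rw [hα, hf3]; omega
  · rw [hα, hf3]; omega

lemma exists_isRim_add {d N q : ℕ} {α : YoungDiagram} (hd : 0 < d) (hN : α.colLen 0 ≤ N)
    (hq : q < N) (hne : ∀ i < N, i ≠ q → beta α i ≠ beta α q + d) :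
    ∃ (ν : YoungDiagram) (p : ℕ), IsRim d ν.rowLen α.rowLen p q := by
  classical
  set y := beta α q + d with hy
  have hex : ∃ i, beta α i < y := ⟨q, by omega⟩
  -- After sorting, `y` takes position `p`; the entries of rows `p, …, q - 1` move down one place,
  -- which gains each of those rows one cell.
  set p := Nat.find hex with hp
  have hpq : p ≤ q := Nat.find_min' hex (by omega)
  have hpy : beta α p < y := Nat.find_spec hex
  have hlt : ∀ i < p, y < beta α i := fun i hi =>
    lt_of_le_of_ne (not_lt.1 (Nat.find_min hex hi)) (hne i (by omega) (by omega)).symm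
  have hanti : ∀ i, α.rowLen (i + 1) ≤ α.rowLen i := fun i =>
    rowLen_antitone α (Nat.le_succ i)
  have hrow : ∀ i < p, y + i + 1 < α.rowLen i := fun i hi => by
    have := hlt i hi; rw [beta] at this; omega
  have hrowp : (α.rowLen p : ℤ) < y + p + 1 := by
    rw [beta] at hpy; omega
  have hrowq : y = α.rowLen q - (q + 1) + d := by rw [hy, beta]
  set f : ℕ → ℕ := fun i => if i < p ∨ q < i then α.rowLen i else
    if i = p then (y + p + 1).toNat else α.rowLen (i - 1) + 1 with hf
  have hf1 : ∀ i, (i < p ∨ q < i) → f i = α.rowLen i := fun i hi => if_pos hi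
  have hf2 : ∀ i, p ≤ i → i < q → f (i + 1) = α.rowLen i + 1 := fun i h1 h2 => by
    simp only [hf]; rw [if_neg (by omega), if_neg (by omega), Nat.add_sub_cancel]
  have hf3 : f p = (y + p + 1).toNat := by
    simp only [hf]; rw [if_neg (by omega), if_true]
  have hfanti : Antitone f := by
    refine antitone_nat_of_succ_le fun i => ?_
    have h1 := hanti i
    rcases lt_trichotomy (i + 1) p with h | h | h
    · rw [hf1 i (by omega), hf1 (i + 1) (by omega)]; exact h1
    · have := hrow i (by omega)
      rw [hf1 i (by omega), h, hf3]; omega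
    · rcases (show p ≤ i by omega).lt_or_eq with h3 | h3
      · obtain ⟨j, rfl⟩ := Nat.exists_eq_succ_of_ne_zero (show i ≠ 0 by omega)
        have h5 := hanti j
        by_cases h4 : j + 1 ≤ q
        · rw [Nat.succ_eq_add_one, hf2 j (by omega) (by omega)]
          by_cases h6 : j + 1 < q
          · rw [hf2 (j + 1) (by omega) h6]; omega
          · rw [hf1 (j + 1 + 1) (by omega)]; rw [Nat.succ_eq_add_one] at h1; omega
        · rw [hf1 _ (by omega), hf1 _ (by omega)]; exact h1
      · subst h3
        rw [hf3]
        by_cases h6 : p < q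
        · rw [hf2 p le_rfl h6]; omega
        · rw [hf1 (p + 1) (by omega)]; omega
  obtain ⟨ν, hν⟩ := exists_rowLen_eq hfanti (N := N) fun i hi => by
    rw [hf1 i (by omega), rowLen_eq_zero (by omega)]
  refine ⟨ν, p, hpq, ?_, ?_, ?_, ?_, ?_⟩
  · intro i hi; rw [hν, hf1 i (Or.inl hi)]
  · intro i hi; rw [hν, hf1 i (Or.inr hi)]
  · intro i h1 h2; rw [hν, hf2 i h1 h2]
  · rw [hν]
    rcases hpq.lt_or_eq with h3 | h3
    · obtain ⟨j, hj⟩ := Nat.exists_eq_succ_of_ne_zero (show q ≠ 0 by omega)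
      have := hanti j
      rw [hj, Nat.succ_eq_add_one, hf2 j (by omega) (by omega)]; omega
    · rw [← h3, hf3]; omega
  · rw [hν, hf3]; omega

section

variable {d p q : ℕ} {lam α : YoungDiagram}

/-- With `IsRim.eq_of_bottom`, this gives the injectivity needed to match sums over strips with sums
over rows of the determinant. -/
lemma IsRim.eq_of_top {q' : ℕ} {α' : YoungDiagram} (h : IsRim d lam.rowLen α.rowLen p q)
    (h' : IsRim d lam.rowLen α'.rowLen p q') : α = α' := by
  have key : ∀ {q q' : ℕ} {α α' : YoungDiagram}, IsRim d lam.rowLen α.rowLen p q →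
      IsRim d lam.rowLen α'.rowLen p q' → ¬ q < q' := by
    intro q q' α α' h h' hlt
    have h1 := h.size
    have h2 := h'.size
    have h3 := h'.last
    have h4 := h.below (q + 1) (Nat.lt_succ_self q)
    have h5 := rowLen_antitone lam (show q + 1 ≤ q' from hlt)
    have h6 := rowLen_antitone α (Nat.le_succ q)
    rw [Nat.succ_eq_add_one] at h6
    omega
  obtain rfl : q = q' := le_antisymm (not_lt.1 (key h' h)) (not_lt.1 (key h h'))
  refine ext_rowLen fun i => ?_
  by_cases h1 : i < p
  · rw [h.above i h1, h'.above i h1]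
  by_cases h2 : q < i
  · rw [h.below i h2, h'.below i h2]
  by_cases h3 : i < q
  · have h4 := h.mid i (by omega) h3
    have h5 := h'.mid i (by omega) h3
    omega
  · obtain rfl : i = q := by omega
    have h4 := h.size
    have h5 := h'.size
    omega

lemma IsRim.eq_of_bottom {p' : ℕ} {lam' : YoungDiagram} (h : IsRim d lam.rowLen α.rowLen p q)
    (h' : IsRim d lam'.rowLen α.rowLen p' q) : lam = lam' := by
  have key : ∀ {p p' : ℕ} {lam lam' : YoungDiagram}, IsRim d lam.rowLen α.rowLen p q →
      IsRim d lam'.rowLen α.rowLen p' q → ¬ p < p' := by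
    intro p p' lam lam' h h' hlt
    obtain ⟨j, rfl⟩ := Nat.exists_eq_succ_of_ne_zero (show p' ≠ 0 by omega)
    rw [Nat.succ_eq_add_one] at h' hlt
    have h0 := h'.le
    have h1 := h.size
    have h2 := h'.size
    have h3 := h.mid j (by omega) (by omega)
    have h4 := h'.above j (Nat.lt_succ_self j)
    have h5 := rowLen_antitone lam' (Nat.le_succ j)
    have h6 := rowLen_antitone lam (show p ≤ j + 1 by omega)
    rw [Nat.succ_eq_add_one] at h5
    omega
  obtain rfl : p = p' := le_antisymm (not_lt.1 (key h' h)) (not_lt.1 (key h h'))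
  refine ext_rowLen fun i => ?_
  by_cases h1 : i < p
  · rw [← h.above i h1, h'.above i h1]
  by_cases h2 : q < i
  · rw [← h.below i h2, h'.below i h2]
  by_cases h3 : i = p
  · subst h3
    have h4 := h.size
    have h5 := h'.size
    omega
  · obtain ⟨j, rfl⟩ := Nat.exists_eq_succ_of_ne_zero (show i ≠ 0 by omega)
    have h4 := h.mid j (by omega) (by omega)
    have h5 := h'.mid j (by omega) (by omega)
    rw [Nat.succ_eq_add_one]
    omega

/-- The cyclic permutation of the entries of `beta` that is caused by a border strip. -/
lemma IsRim.beta_comp_cycleIcc {N : ℕ} (h : IsRim d lam.rowLen α.rowLen p q) (hq : q < N) :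
    ∃ σ : Equiv.Perm (Fin N), Equiv.Perm.sign σ = (-1) ^ (q - p) ∧
      (∀ i : Fin N, ((i : ℕ) ≠ q → beta lam (σ i) = beta α i ∧ (σ i : ℕ) ≠ p)) ∧
      (σ ⟨q, hq⟩ : ℕ) = p ∧ beta lam p = beta α q + d := by
  have hp : p < N := h.le.trans_lt hq
  have : NeZero N := ⟨by omega⟩
  have hle : (⟨p, hp⟩ : Fin N) ≤ ⟨q, hq⟩ := h.le
  refine ⟨Fin.cycleIcc ⟨p, hp⟩ ⟨q, hq⟩, Fin.sign_cycleIcc_of_le hle, ?_, ?_, ?_⟩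
  · intro i hi
    by_cases h1 : (i : ℕ) < p
    · rw [Fin.cycleIcc_of_lt (by exact h1), beta, beta, h.above i h1]
      exact ⟨rfl, by omega⟩
    by_cases h2 : q < i
    · rw [Fin.cycleIcc_of_gt (by exact h2), beta, beta, h.below i h2]
      have := h.le
      exact ⟨rfl, by omega⟩
    · have h3 := h.mid i (by omega) (by omega)
      have h4 : ((i + 1 : Fin N) : ℕ) = i + 1 := Fin.val_add_one_of_lt' (by omega)
      rw [Fin.cycleIcc_of_ge_of_lt (by rw [Fin.le_def]; simp only; omega)
        (by rw [Fin.lt_def]; simp only; omega), h4]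
      refine ⟨?_, by omega⟩
      rw [beta, beta]
      push_cast
      omega
  · rw [Fin.cycleIcc_of_last hle]
  · have := h.size
    rw [beta, beta]
    omega

lemma IsRim.betaDet_remove {N : ℕ} (h : IsRim d lam.rowLen α.rowLen p q) (hp : p < N)
    (hq : q < N) : betaDet (Function.update (fun i : Fin N => beta lam i) ⟨p, hp⟩
      (beta lam p - d)) = (-1) ^ (q - p) * betaDet fun i : Fin N => beta α i := by
  obtain ⟨σ, hs, h1, h2, h3⟩ := h.beta_comp_cycleIcc hq
  have h4 : (fun i : Fin N => beta α i) = Function.update (fun i : Fin N => beta lam i) ⟨p, hp⟩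
      (beta lam p - d) ∘ σ := by
    funext i
    rw [Function.comp_apply]
    by_cases hi : (i : ℕ) = q
    · obtain rfl : i = ⟨q, hq⟩ := Fin.ext hi
      rw [show σ ⟨q, hq⟩ = ⟨p, hp⟩ from Fin.ext h2, Function.update_self, h3]
      simp
    · rw [Function.update_of_ne fun h' => (h1 i hi).2 (congrArg Fin.val h'), (h1 i hi).1]
  rw [h4, betaDet_comp_perm, hs]
  push_cast
  rw [← mul_assoc, ← mul_pow]
  simp

lemma IsRim.betaDet_add {N : ℕ} (h : IsRim d lam.rowLen α.rowLen p q) (hq : q < N) :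
    betaDet (Function.update (fun i : Fin N => beta α i) ⟨q, hq⟩ (beta α q + d)) =
      (-1) ^ (q - p) * betaDet fun i : Fin N => beta lam i := by
  obtain ⟨σ, hs, h1, h2, h3⟩ := h.beta_comp_cycleIcc hq
  have h4 : Function.update (fun i : Fin N => beta α i) ⟨q, hq⟩ (beta α q + d) =
      (fun i : Fin N => beta lam i) ∘ σ := by
    funext i
    rw [Function.comp_apply]
    by_cases hi : (i : ℕ) = q
    · obtain rfl : i = ⟨q, hq⟩ := Fin.ext hi
      rw [Function.update_self, h2, h3]
    · rw [Function.update_of_ne fun h' => hi (congrArg Fin.val h'), (h1 i hi).1]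
  rw [h4, betaDet_comp_perm, hs]
  push_cast
  rfl

end

/-! ### Expansions over border strips -/

lemma colLen_le_of_rowLen_eq_zero {lam : YoungDiagram} {N : ℕ} (h : lam.rowLen N = 0) :
    lam.colLen 0 ≤ N := by
  by_contra hc
  have := rowLen_pos_iff.2 (not_le.1 hc)
  omega

open Classical in
/-- `p_d^⊥` removes border strips of size `d`. -/
lemma sum_remove_strips {d : ℕ} (hd : 0 < d) (lam : YoungDiagram) (ht : YoungDiagram → ℕ)
    (hht : ∀ α p q, IsRim d lam.rowLen α.rowLen p q → ht α = q - p) :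
    ∑ α ∈ subpartitions lam with ∃ p q, IsRim d lam.rowLen α.rowLen p q,
      (-1) ^ ht α * stableSchur α = skewP d (stableSchur lam) := by
  set N := lam.colLen 0 with hN
  have hqN : ∀ (α : YoungDiagram) (p q : ℕ), IsRim d lam.rowLen α.rowLen p q → q < N := fun α p q h =>
    rowLen_pos_iff.1 (by have := h.last; omega)
  have hpN : ∀ (α : YoungDiagram) (p q : ℕ), IsRim d lam.rowLen α.rowLen p q → p < N := fun α p q h =>
    h.le.trans_lt (hqN α p q h)
  have hterm : ∀ (α : YoungDiagram) (p q : ℕ) (h : IsRim d lam.rowLen α.rowLen p q), (-1) ^ ht α * stableSchur α =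
      betaDet (Function.update (fun i : Fin N => beta lam i) ⟨p, hpN α p q h⟩
        (beta lam p - d)) := by
    intro α p q h
    have h1 := h.betaDet_remove (hpN α p q h) (hqN α p q h)
    have h2 : α.colLen 0 ≤ N := colLen_le_of_rowLen_eq_zero (by
      have h3 := h.le_rows (rowLen_antitone lam) N
      have h4 : lam.rowLen N = 0 := rowLen_eq_zero le_rfl
      omega)
    rw [h1, hht α p q h, ← stableSchurAux_eq h2]
    rfl
  have hch : ∀ α : YoungDiagram,
      α ∈ (subpartitions lam).filter (fun α : YoungDiagram => ∃ p q, IsRim d lam.rowLen α.rowLen p q) →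
      ∃ p q, IsRim d lam.rowLen α.rowLen p q := fun α h => (mem_filter.1 h).2
  choose! P Q hPQ using hch
  rw [stableSchur, stableSchurAux, skewP_betaDet hd]
  -- Strips are matched with their top rows. A row that is no top has a lowered entry that is
  -- inadmissible or equal to another one, and contributes zero.
  refine Finset.sum_bij_ne_zero (fun α hα _ => ⟨P α, hpN _ _ _ (hPQ α hα)⟩) ?_ ?_ ?_ ?_
  · simp
  · intro α hα _ α' hα' _ h
    have h1 := hPQ α hα
    rw [show P α = P α' from congrArg Fin.val h] at h1
    exact h1.eq_of_top (hPQ α' hα')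
  · intro p _ hp
    obtain ⟨α, q, h⟩ := exists_isRim_remove (N := N) (p := p) (lam := lam) hd le_rfl p.2
      (by
        by_contra hc
        refine hp (betaDet_eq_zero_of_lt (i := p) ?_)
        rw [Function.update_self]
        exact not_le.1 hc)
      (by
        intro i hi hip h
        have hne : (⟨i, hi⟩ : Fin N) ≠ p := fun h' => hip (congrArg Fin.val h')
        refine hp (betaDet_eq_zero_of_eq hne ?_)
        rw [Function.update_self, Function.update_of_ne hne]
        exact h)
    have hα : α ∈ (subpartitions lam).filter fun α : YoungDiagram =>
        ∃ p q, IsRim d lam.rowLen α.rowLen p q := by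
      rw [mem_filter, mem_subpartitions]
      exact ⟨le_iff_rowLen.2 (h.le_rows (rowLen_antitone lam)), _, _, h⟩
    refine ⟨α, hα, ?_, ?_⟩
    · rw [hterm α _ _ h]
      exact hp
    · exact Fin.ext ((hPQ α hα).unique (rowLen_antitone lam) h).1
  · intro α hα _
    exact hterm α _ _ (hPQ α hα)

open Classical in
/-- Multiplication by `p_d - 1` adds border strips of size `d`. -/
lemma sum_add_strips {d : ℕ} (hd : 0 < d) (α : YoungDiagram) (F : Finset YoungDiagram)
    (hF : ∀ ν p q, IsRim d ν.rowLen α.rowLen p q → ν ∈ F) (ht : YoungDiagram → ℕ)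
    (hht : ∀ ν p q, IsRim d ν.rowLen α.rowLen p q → ht ν = q - p) :
    ∑ ν ∈ F with ∃ p q, IsRim d ν.rowLen α.rowLen p q,
      (-1) ^ ht ν * stableSchur ν = (pSum d - 1) * stableSchur α := by
  -- The `d` additional zero rows supply the `d` lowest values required by `pSum_mul_betaDet` and
  -- leave room for strips reaching below `α`.
  set N := α.colLen 0 + d with hN
  have hqN : ∀ (ν : YoungDiagram) (p q : ℕ), IsRim d ν.rowLen α.rowLen p q → q < N := by
    intro ν p q h
    have h1 := h.size
    have h2 := h.last
    have h3 := rowLen_antitone ν h.le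
    have h4 : p ≤ α.colLen 0 := by
      by_contra hc
      have h5 := h.above (α.colLen 0) (by omega)
      have h6 : α.rowLen (α.colLen 0) = 0 := rowLen_eq_zero le_rfl
      have h7 := rowLen_antitone ν (show α.colLen 0 ≤ p by omega)
      omega
    by_contra hc
    have h5 : α.rowLen q = 0 := rowLen_eq_zero (by omega)
    omega
  have hterm : ∀ (ν : YoungDiagram) (p q : ℕ) (h : IsRim d ν.rowLen α.rowLen p q), (-1) ^ ht ν * stableSchur ν =
      betaDet (Function.update (fun i : Fin N => beta α i) ⟨q, hqN ν p q h⟩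
        (beta α q + d)) := by
    intro ν p q h
    have h1 := h.betaDet_add (hqN ν p q h)
    have h2 : ν.colLen 0 ≤ N := colLen_le_of_rowLen_eq_zero (by
      rw [← h.below N (hqN ν p q h)]
      exact rowLen_eq_zero (by omega))
    rw [h1, hht ν p q h, ← stableSchurAux_eq h2]
    rfl
  have hch : ∀ ν : YoungDiagram,
      ν ∈ F.filter (fun ν : YoungDiagram => ∃ p q, IsRim d ν.rowLen α.rowLen p q) →
      ∃ p q, IsRim d ν.rowLen α.rowLen p q := fun α h => (mem_filter.1 h).2
  choose! P Q hPQ using hch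
  rw [← stableSchurAux_eq (show α.colLen 0 ≤ N by omega), stableSchurAux, pSum_mul_betaDet hd]
  -- Here a strip is matched with its bottom row, whose entry is the one raised by `d`.
  · refine Finset.sum_bij_ne_zero (fun ν hν _ => ⟨Q ν, hqN _ _ _ (hPQ ν hν)⟩) ?_ ?_ ?_ ?_
    · simp
    · intro ν hν _ ν' hν' _ h
      have h1 := hPQ ν hν
      rw [show Q ν = Q ν' from congrArg Fin.val h] at h1
      exact h1.eq_of_bottom (hPQ ν' hν')
    · intro q _ hq
      obtain ⟨ν, p, h⟩ := exists_isRim_add (N := N) (q := q) (α := α) hd (by omega) q.2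
        (by
          intro i hi hiq h
          have hne : (⟨i, hi⟩ : Fin N) ≠ q := fun h' => hiq (congrArg Fin.val h')
          refine hq (betaDet_eq_zero_of_eq hne ?_)
          rw [Function.update_self, Function.update_of_ne hne]
          exact h)
      have hν : ν ∈ F.filter fun ν : YoungDiagram => ∃ p q, IsRim d ν.rowLen α.rowLen p q := by
        rw [mem_filter]
        exact ⟨hF ν _ _ h, _, _, h⟩
      refine ⟨ν, hν, ?_, ?_⟩
      · rw [hterm ν _ _ h]
        exact hq
      · exact Fin.ext ((hPQ ν hν).unique (rowLen_antitone ν) h).2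
    · intro ν hν _
      exact hterm ν _ _ (hPQ ν hν)
  · intro i; omega
  · intro x h1 h2
    refine ⟨⟨(-x - 1).toNat, by omega⟩, ?_⟩
    rw [rowLen_eq_zero (by simp only; omega)]
    simp only
    omega

/-! ### The irreducible character basis as an image -/

/-- The span of the products `h_γ` of degree `w`. -/
noncomputable def hDegree (w : ℤ) : Submodule ℚ SymF :=
  Submodule.span ℚ {f | ∃ γ : Multiset ℕ, (γ.sum : ℤ) = w ∧ hProd γ = f}

lemma prod_completeHInt_mem {ι : Type*} (s : Finset ι) (n : ι → ℤ) :
    ∏ i ∈ s, completeHInt (n i) ∈ hDegree (∑ i ∈ s, n i) := by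
  by_cases h : ∃ i ∈ s, n i < 0
  · obtain ⟨i, hi, hn⟩ := h
    rw [Finset.prod_eq_zero hi (by rw [completeHInt, if_pos hn])]
    exact Submodule.zero_mem _
  · push Not at h
    refine Submodule.subset_span ⟨s.val.map fun i => (n i).toNat, ?_, ?_⟩
    · change ((∑ i ∈ s, (n i).toNat : ℕ) : ℤ) = _
      rw [Nat.cast_sum]
      exact Finset.sum_congr rfl fun i hi => Int.toNat_of_nonneg (h i hi)
    · rw [hProd, Multiset.map_map]
      refine Finset.prod_congr rfl fun i hi => ?_
      rw [Function.comp_apply, completeHInt, if_neg (not_lt.2 (h i hi))]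

/-- In every permutation term the degrees add up to the same number, since the columns used are all
but column `j`. -/
lemma det_minor_mem {N : ℕ} (v : Fin N → ℤ) (j : Fin (N + 1)) :
    ((betaMatrix v).submatrix Fin.succ j.succAbove).det ∈
      hDegree (∑ i, (v i + (i + 1)) - (j : ℕ)) := by
  rw [Matrix.det_apply]
  refine Submodule.sum_mem _ fun σ _ => ?_
  rw [Units.smul_def]
  refine zsmul_mem ?_ _
  have h := prod_completeHInt_mem univ fun i => v (σ i) + (j.succAbove i : ℕ)
  have h1 : ∑ i, (v (σ i) + ((j.succAbove i : ℕ) : ℤ)) = ∑ i, (v i + (i + 1)) - (j : ℕ) := by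
    have h2 := Fin.sum_univ_succAbove (fun c : Fin (N + 1) => ((c : ℕ) : ℤ)) j
    rw [Fin.sum_univ_succ] at h2
    simp only [Fin.val_zero, Fin.val_succ, Nat.cast_zero, zero_add, Nat.cast_add,
      Nat.cast_one] at h2
    rw [Finset.sum_add_distrib, Finset.sum_add_distrib, Equiv.sum_comp σ v, h2]
    ring
  rw [h1] at h
  exact h

lemma hCoeff_hProd (β γ : Multiset ℕ) :
    hCoeff β (hProd γ) = if γ.filter (0 < ·) = β.filter (0 < ·) then 1 else 0 := by
  rw [hCoeff, equivH_symm_hProd, coeff_monomial]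
  congr 1
  rw [eq_iff_iff]
  constructor
  · intro h
    rw [← exponentParts_hExponent, h, exponentParts_hExponent]
  · intro h
    rw [← hExponent_exponentParts (hExponent γ), exponentParts_hExponent, h,
      ← exponentParts_hExponent, hExponent_exponentParts]

/-- The coefficient of `h_β` as a linear form. -/
noncomputable def hCoeffLinear (β : Multiset ℕ) : SymF →ₗ[ℚ] ℚ :=
  lcoeff ℚ (hExponent β) ∘ₗ equivH.symm.toLinearMap

lemma hCoeffLinear_apply (β : Multiset ℕ) (f : SymF) : hCoeffLinear β f = hCoeff β f := rfl

/-- The linear map that removes the factor `h_{2L - m}` from products `h_{2L - m} h_μ` with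
`|μ| = m ≤ L`. -/
noncomputable def removeFirst (L : ℕ) : SymF →ₗ[ℚ] SymF :=
  ∑ m ∈ range (L + 1), ∑ μ : m.Partition,
    (hCoeffLinear ((2 * L - m) ::ₘ μ.parts)).smulRight (hProd μ.parts)

lemma removeFirst_apply (L : ℕ) (f : SymF) : removeFirst L f =
    ∑ m ∈ range (L + 1), ∑ μ : m.Partition,
      hCoeff ((2 * L - m) ::ₘ μ.parts) f • hProd μ.parts := by
  simp [removeFirst, hCoeffLinear_apply]

lemma filter_pos_parts {m : ℕ} (μ : m.Partition) : μ.parts.filter (0 < ·) = μ.parts :=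
  Multiset.filter_eq_self.2 fun _ h => μ.parts_pos h

/-- The parts of `μ` are at most `m ≤ L`, so the factor `h_{2L - m}` is recognisable in the product;
this is why `n = 2|λ|` is large enough. -/
lemma removeFirst_hProd {L j : ℕ} (hj : j ≤ L) {γ : Multiset ℕ} (hγ : γ.sum = L - j) :
    removeFirst L (completeH (L + j) * hProd γ) = hProd γ := by
  have h1 : completeH (L + j) * hProd γ = hProd ((L + j) ::ₘ γ) := by simp [hProd]
  have hsum : (γ.filter (0 < ·)).sum = L - j := by
    rw [← hγ]
    conv_rhs => rw [← Multiset.filter_add_not (0 < ·) γ]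
    rw [Multiset.sum_add, left_eq_add, Multiset.sum_eq_zero_iff]
    intro x hx
    have := (Multiset.mem_filter.1 hx).2
    omega
  let μ₀ : (L - j).Partition := ⟨γ.filter (0 < ·), fun h => (Multiset.mem_filter.1 h).2, hsum⟩
  have key : ∀ m ≤ L, ∀ μ : m.Partition, ((L + j) ::ₘ γ).filter (0 < ·) =
      ((2 * L - m) ::ₘ μ.parts).filter (0 < ·) → m = L - j ∧ μ.parts = γ.filter (0 < ·) := by
    intro m hm μ h
    rcases Nat.eq_zero_or_pos L with rfl | hL
    · obtain rfl : j = 0 := by omega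
      obtain rfl : m = 0 := by omega
      rw [Multiset.filter_cons_of_neg _ (by simp), Multiset.filter_cons_of_neg _ (by simp),
        filter_pos_parts] at h
      exact ⟨rfl, h.symm⟩
    · rw [Multiset.filter_cons_of_pos (p := (0 < ·)) _ (by omega),
        Multiset.filter_cons_of_pos (p := (0 < ·)) _ (by omega), filter_pos_parts] at h
      have hmem : L + j ∈ (2 * L - m) ::ₘ μ.parts := by
        rw [← h]; exact Multiset.mem_cons_self _ _
      have hm' : 2 * L - m = L + j := by
        rcases Multiset.mem_cons.1 hmem with h2 | h2
        · exact h2.symm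
        -- If `L + j` is a part of `μ`, then `L + j ≤ m ≤ L` forces `j = 0` and `m = L`, and the two
        -- factors coincide.
        · have := Multiset.le_sum_of_mem h2
          rw [μ.parts_sum] at this
          omega
      rw [hm', Multiset.cons_inj_right] at h
      exact ⟨by omega, h.symm⟩
  rw [removeFirst_apply, h1, Finset.sum_eq_single (L - j)]
  · rw [Finset.sum_eq_single μ₀]
    · rw [hCoeff_hProd, if_pos, one_smul]
      · exact hProd_filter_pos γ
      · rw [show 2 * L - (L - j) = L + j by omega]
        change _ = ((L + j) ::ₘ γ.filter (0 < ·)).filter (0 < ·)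
        rw [Multiset.filter_cons, Multiset.filter_cons, Multiset.filter_filter]
        simp
    · intro μ _ hμ
      rw [hCoeff_hProd, if_neg, zero_smul]
      intro h
      exact hμ (Nat.Partition.ext (key _ (by omega) μ h).2)
    · simp
  · intro m hm hne
    rw [mem_range] at hm
    refine Finset.sum_eq_zero fun μ _ => ?_
    rw [hCoeff_hProd, if_neg, zero_smul]
    intro h
    exact hne (key m (by omega) μ h).1
  · intro h
    exact absurd (mem_range.2 (by omega)) h

lemma removeFirst_mul {L j : ℕ} (hj : j ≤ L) {f : SymF} (hf : f ∈ hDegree ((L : ℤ) - j)) :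
    removeFirst L (completeH (L + j) * f) = f := by
  induction hf using Submodule.span_induction with
  | mem f hf =>
    obtain ⟨γ, hγ, rfl⟩ := hf
    exact removeFirst_hProd hj (by omega)
  | zero => simp
  | add f g _ _ h1 h2 => rw [mul_add, map_add, h1, h2]
  | smul c f _ h => rw [mul_smul_comm, map_smul, h]

lemma sum_rowLens (lam : YoungDiagram) : lam.rowLens.sum = lam.card := by
  have := card_ofParts (lam.rowLens : Multiset ℕ)
  rw [ofParts_rowLens, Multiset.sum_coe] at this
  exact this.symm

lemma colLen_le_card (lam : YoungDiagram) (j : ℕ) : lam.colLen j ≤ lam.card := by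
  rw [YoungDiagram.colLen_eq_card]
  exact Finset.card_le_card (Finset.filter_subset _ _)

/-- Expand both determinants along the first row. The cofactors are the same, that of column `j` has
degree `|λ| - j`, and the entries `h_{|λ| + j}` are what `removeFirst` replaces by `1`. -/
lemma removeFirst_schur (lam : YoungDiagram) :
    removeFirst lam.card (schur ((2 * lam.card - lam.card) :: lam.rowLens)) =
      stableSchur lam := by
  set N := lam.rowLens.length with hN
  have hNcol : N = lam.colLen 0 := YoungDiagram.length_rowLens
  set v : Fin N → ℤ := fun i => (lam.rowLen i : ℤ) - (i + 1) with hv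
  set B : Fin (N + 1) → SymF := fun j =>
    ((betaMatrix v).submatrix Fin.succ j.succAbove).det with hB
  have hs : stableSchur lam =
      ∑ j : Fin (N + 1), (-1 : ℚ) ^ (j : ℕ) • B j := by
    rw [← stableSchurAux_eq (show lam.colLen 0 ≤ N from hNcol.ge), stableSchurAux, betaDet,
      Matrix.det_succ_row_zero]
    refine Finset.sum_congr rfl fun j _ => ?_
    rw [betaMatrix_zero, mul_one, Algebra.smul_def, map_pow, map_neg, map_one]
  have hschur : schur ((2 * lam.card - lam.card) :: lam.rowLens) =
      ∑ j : Fin (N + 1), (-1 : ℚ) ^ (j : ℕ) • (completeH (lam.card + j) * B j) := by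
    rw [schur]
    refine (Matrix.det_succ_row_zero (n := N) _).trans (Finset.sum_congr rfl fun j _ => ?_)
    rw [mul_assoc, Algebra.smul_def, map_pow, map_neg, map_one]
    congr 2
    · rw [Matrix.of_apply]
      have : (((2 * lam.card - lam.card) :: lam.rowLens).get (0 : Fin (N + 1)) : ℕ) =
        lam.card := by
        change 2 * lam.card - lam.card = lam.card
        omega
      rw [this, completeHInt, if_neg (by simp; omega)]
      congr 1
    · rw [hB]
      congr 1
      ext1 i c
      rw [Matrix.submatrix_apply, Matrix.submatrix_apply, Matrix.of_apply, betaMatrix_succ]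
      congr 1
      have : (((2 * lam.card - lam.card) :: lam.rowLens).get (i.succ : Fin (N + 1)) : ℕ) =
          lam.rowLen i := by
        change lam.rowLens[(i : ℕ)] = _
        exact YoungDiagram.get_rowLens
      rw [this, hv, Fin.val_succ]
      push_cast
      ring
  have hdeg : ∑ i, (v i + ((i : ℕ) + 1)) = (lam.card : ℤ) := by
    have h1 : ∀ i : Fin N, v i + ((i : ℕ) + 1) = (lam.rowLen i : ℤ) := fun i => by
      rw [hv]; ring
    rw [Finset.sum_congr rfl fun i _ => h1 i, ← sum_rowLens, ← Nat.cast_sum,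
      Fin.sum_univ_eq_sum_range (fun i => lam.rowLen i), hNcol]
    rfl
  rw [hs, hschur, map_sum]
  refine Finset.sum_congr rfl fun j _ => ?_
  have hj : (j : ℕ) ≤ lam.card := by
    have h1 := j.2
    have h2 := colLen_le_card lam 0
    omega
  have hmem := det_minor_mem v j
  rw [hdeg] at hmem
  rw [map_smul, removeFirst_mul hj hmem]

/-- The irreducible character basis is the image of the stable Schur functions. -/
theorem theta_stableSchur (lam : YoungDiagram) : theta (stableSchur lam) = irreducible lam := by
  rw [← removeFirst_schur, removeFirst_apply, map_sum, irreducible]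
  refine Finset.sum_congr rfl fun m _ => ?_
  rw [map_sum]
  refine Finset.sum_congr rfl fun μ _ => ?_
  rw [map_smul, theta_hProd, inverseKostka]

/-! ### The multiplication rule -/

/-- `λ // α` is a border strip of size `d` (in terms of row lengths). -/
def IsStableStrip (d : ℕ) (lam α : YoungDiagram) : Prop :=
  α = lam ∨ ∃ p q, IsRim d lam.rowLen α.rowLen p q

/-- The height of `λ // α`, computed in a sufficiently large size. -/
def stableHeight (d : ℕ) (lam α : YoungDiagram) : ℕ :=
  height (d + 2 * lam.card + 2 * α.card) d lam α

section

variable {r d : ℕ} {lam α : YoungDiagram}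

lemma stableHeight_self (hd : 0 < d) : stableHeight d lam lam = 0 :=
  height_self hd (by omega) (by omega)

lemma IsRim.stableHeight_eq {p q : ℕ} (h : IsRim d lam.rowLen α.rowLen p q) :
    stableHeight d lam α = q - p :=
  h.height_eq (by omega)

lemma IsStableStrip.card_le (h : IsStableStrip d lam α) : lam.card ≤ α.card + d := by
  rcases h with rfl | ⟨p, q, h⟩
  · omega
  · exact h.card_add.ge

lemma height_eq_stableHeight (hd : 0 < d) (h1 : 2 * lam.card ≤ r)
    (h2 : d + α.card + lam.card ≤ r) (h : IsStableStrip d lam α) :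
    height r d lam α = stableHeight d lam α := by
  rcases h with rfl | ⟨p, q, h⟩
  · rw [height_self hd h1 (by omega), stableHeight_self hd]
  · rw [h.height_eq h1, h.stableHeight_eq]

end

lemma IsRim.ne {d p q : ℕ} {lam α : YoungDiagram} (h : IsRim d lam.rowLen α.rowLen p q) :
    α ≠ lam := by
  rintro rfl
  exact lt_irrefl _ h.last

-- The summand without `skewP` is the term `α = λ`, a strip of height zero in the first row.
open Classical in
lemma sum_remove_stableStrips {d : ℕ} (hd : 0 < d) (lam : YoungDiagram) :
    ∑ α ∈ subpartitions lam with IsStableStrip d lam α,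
      (-1) ^ stableHeight d lam α * stableSchur α =
        skewP d (stableSchur lam) + stableSchur lam := by
  have hsplit : ((subpartitions lam).filter fun α => IsStableStrip d lam α) =
      {lam} ∪ (subpartitions lam).filter fun α => ∃ p q, IsRim d lam.rowLen α.rowLen p q := by
    ext α
    rw [mem_filter, mem_union, mem_singleton, mem_filter, IsStableStrip, and_or_left]
    exact or_congr_left (and_iff_right_of_imp fun h => h ▸ mem_subpartitions.2 le_rfl)
  rw [hsplit, Finset.sum_union, sum_remove_strips hd lam _
    fun α p q h => h.stableHeight_eq, add_comm, sum_singleton, stableHeight_self hd, pow_zero, one_mul]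
  rw [Finset.disjoint_singleton_left, mem_filter]
  rintro ⟨_, p, q, h⟩
  exact h.ne rfl

-- Write `p_d = (p_d - 1) + 1`; the `1` is the term `ν = α`.
open Classical in
lemma sum_add_stableStrips {d : ℕ} (hd : 0 < d) (α : YoungDiagram) (F : Finset YoungDiagram)
    (hF : ∀ ν, IsStableStrip d ν α → ν ∈ F) :
    ∑ ν ∈ F with IsStableStrip d ν α, (-1) ^ stableHeight d ν α * stableSchur ν =
      pSum d * stableSchur α := by
  have hsplit : (F.filter fun ν => IsStableStrip d ν α) =
      {α} ∪ F.filter fun ν => ∃ p q, IsRim d ν.rowLen α.rowLen p q := by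
    ext ν
    rw [mem_filter, mem_union, mem_singleton, mem_filter, IsStableStrip, and_or_left,
      eq_comm (a := α)]
    exact or_congr_left (and_iff_right_of_imp fun h => h ▸ hF α (Or.inl rfl))
  rw [hsplit, Finset.sum_union, sum_add_strips hd α F
    (fun ν p q h => hF ν (Or.inr ⟨p, q, h⟩)) (stableHeight d · α) fun ν p q h => h.stableHeight_eq,
    sum_singleton, stableHeight_self hd]
  · ring
  rw [Finset.disjoint_singleton_left, mem_filter]
  rintro ⟨_, p, q, h⟩
  exact h.ne rfl

-- As `d ≤ k` and `|α| ≤ |λ|`, the bound on `r` puts both skew shapes in the stable range, where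
-- strips and heights no longer depend on `r`.
open Classical in
lemma coefficient_eq {r k : ℕ} {lam ν : YoungDiagram}
    (hr : k + 2 * lam.card + 2 * ν.card ≤ r) : coefficient r k lam ν =
      ∑ d ∈ k.divisors, ∑ α ∈ subpartitions lam with
        IsStableStrip d lam α ∧ IsStableStrip d ν α,
        (-1) ^ (stableHeight d lam α + stableHeight d ν α) := by
  rw [coefficient]
  refine Finset.sum_congr rfl fun d hd => ?_
  have hd0 : 0 < d := Nat.pos_of_mem_divisors hd
  have hdk : d ≤ k := Nat.divisor_le hd
  have hα : ∀ α ∈ subpartitions lam, α.card ≤ lam.card := fun α h =>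
    Finset.card_le_card (YoungDiagram.cells_subset_iff.2 (mem_subpartitions.1 h))
  refine Finset.sum_congr (Finset.filter_congr fun α h => ?_) fun α h => ?_
  · have := hα α h
    rw [isDoubleSlashStrip_iff hd0 (by omega) (by omega) (by omega),
      isDoubleSlashStrip_iff hd0 (by omega) (by omega) (by omega)]
    rfl
  · rw [mem_filter] at h
    have := hα α h.1
    rw [height_eq_stableHeight hd0 (by omega) (by omega) h.2.1,
      height_eq_stableHeight hd0 (by omega) (by omega) h.2.2]

lemma card_le_of_coefficient_ne_zero {r k : ℕ} {lam ν : YoungDiagram}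
    (hr : k + 2 * lam.card + 2 * ν.card ≤ r) (h : coefficient r k lam ν ≠ 0) :
    ν.card ≤ lam.card + k := by
  classical
  rw [coefficient_eq hr] at h
  obtain ⟨d, hd, h⟩ := Finset.exists_ne_zero_of_sum_ne_zero h
  obtain ⟨α, hα, _⟩ := Finset.exists_ne_zero_of_sum_ne_zero h
  rw [mem_filter, mem_subpartitions] at hα
  have h1 : α.card ≤ lam.card := Finset.card_le_card (YoungDiagram.cells_subset_iff.2 hα.1)
  have h2 := hα.2.2.card_le
  have h3 : d ≤ k := Nat.divisor_le hd
  omega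

lemma finite_card_le (n : ℕ) : {ν : YoungDiagram | ν.card ≤ n}.Finite := by
  refine Set.Finite.of_injOn (f := YoungDiagram.cells)
    (t := ((range n ×ˢ range n).powerset : Finset (Finset (ℕ × ℕ)))) ?_
    cells_injective.injOn (Finset.finite_toSet _)
  intro ν hν
  rw [mem_coe, mem_powerset]
  rintro ⟨i, j⟩ h
  rw [YoungDiagram.mem_cells] at h
  have h1 := YoungDiagram.mem_iff_lt_rowLen.1 h
  have h2 := YoungDiagram.mem_iff_lt_colLen.1 h
  have h3 := rowLen_le_card ν i
  have h4 := colLen_le_card ν j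
  have h5 : ν.card ≤ n := hν
  rw [mem_product, mem_range, mem_range]
  exact ⟨by omega, by omega⟩

/-- For each `d ∣ k`, `p_d^⊥ + 1` removes a strip to reach `α` and `p_d` adds one to reach `ν`;
exchanging the sums collects the coefficient of each `ν`. -/
lemma divisorOp_stableSchur {k : ℕ} {lam : YoungDiagram} {r : YoungDiagram → ℕ}
    (hr : ∀ ν, k + 2 * lam.card + 2 * ν.card ≤ r ν) (F : Finset YoungDiagram)
    (hF : ∀ ν, ν.card ≤ lam.card + k → ν ∈ F) :
    divisorOp k (stableSchur lam) = ∑ ν ∈ F, coefficient (r ν) k lam ν • stableSchur ν := by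
  classical
  have hcoef : ∀ ν ∈ F, coefficient (r ν) k lam ν • stableSchur ν =
      ∑ d ∈ k.divisors, ∑ α ∈ subpartitions lam with IsStableStrip d lam α,
        if IsStableStrip d ν α then (-1) ^ stableHeight d lam α *
          ((-1) ^ stableHeight d ν α * stableSchur ν) else 0 := by
    intro ν _
    rw [coefficient_eq (hr ν), Finset.sum_smul]
    refine Finset.sum_congr rfl fun d _ => ?_
    rw [Finset.sum_smul, ← Finset.sum_filter, Finset.filter_filter]
    refine Finset.sum_congr rfl fun α _ => ?_
    rw [Algebra.smul_def, map_pow, map_neg, map_one, pow_add, mul_assoc]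
  rw [Finset.sum_congr rfl hcoef, Finset.sum_comm, divisorOp_apply]
  refine Finset.sum_congr rfl fun d hd => ?_
  have hd0 : 0 < d := Nat.pos_of_mem_divisors hd
  rw [Finset.sum_comm, ← sum_remove_stableStrips hd0, Finset.mul_sum]
  refine Finset.sum_congr rfl fun α hα => ?_
  rw [← Finset.sum_filter, ← Finset.mul_sum, sum_add_stableStrips hd0]
  · ring
  · intro ν hν
    rw [mem_filter, mem_subpartitions] at hα
    have h1 : α.card ≤ lam.card := Finset.card_le_card (YoungDiagram.cells_subset_iff.2 hα.1)
    have h2 := hν.card_le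
    have h3 : d ≤ k := Nat.divisor_le hd
    exact hF ν (by omega)

end IrrChar

theorem mainTheorem5 (k : ℕ+) (lam : YoungDiagram)
    (r : YoungDiagram → ℕ) (hr : ∀ ν, (k : ℕ) + 2 * lam.card + 2 * ν.card ≤ r ν) :
    {ν : YoungDiagram | IrrChar.coefficient (r ν) k lam ν ≠ 0}.Finite ∧
      IrrChar.powerSum k * IrrChar.irreducible lam =
        ∑ᶠ ν : YoungDiagram,
          IrrChar.coefficient (r ν) k lam ν • IrrChar.irreducible ν := by
  have hfin := IrrChar.finite_card_le (lam.card + k)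
  have hsub : ∀ ν, IrrChar.coefficient (r ν) k lam ν ≠ 0 → ν.card ≤ lam.card + k := fun ν h =>
    IrrChar.card_le_of_coefficient_ne_zero (hr ν) h
  refine ⟨hfin.subset hsub, ?_⟩
  rw [finsum_eq_sum_of_support_subset (s := hfin.toFinset)]
  · have hp : IrrChar.powerSum k = IrrChar.pSum k := by rw [IrrChar.pSum, PNat.coe_toPNat']
    rw [hp, ← IrrChar.theta_stableSchur, ← IrrChar.theta_divisorOp k.pos,
      IrrChar.divisorOp_stableSchur hr hfin.toFinset fun ν h => hfin.mem_toFinset.2 h, map_sum]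
    exact Finset.sum_congr rfl fun ν _ => by rw [map_smul, IrrChar.theta_stableSchur]
  · intro ν hν
    rw [Function.mem_support] at hν
    rw [Finset.mem_coe, hfin.mem_toFinset]
    exact hsub ν fun h => hν (by rw [h, zero_smul])
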